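/- Let $C=\mathbb{P}^1_{\mathbb{C}}$ and let $p_1,\dots,p_5\in C$ be five distinct points. Embed $C$ as the diagonal conic in $S^2C\cong\mathbb{P}^2$, and let $t_i=p_i+C\subset S^2C$ be the line tangent to $C$ at $p_i$. Let $X$ be the del Pezzo surface obtained by blowing up $S^2C$ at $p_1,\dots,p_5$, anticanonically embedded in $\mathbb{P}^4$: the linear system of plane cubics through $p_1,\dots,p_5$ has (vector space) dimension $5$, and for any choice of a basis of it, $X\subset\mathbb{P}^4$ is the Zariski closure of the image of $S^2C\setminus\{p_1,\dots,p_5\}$ under the map given by this basis. The quadrics containing $X$ form a pencil $\{Q_\lambda\}_{\lambda\in\Lambda}$, where $\Lambda\cong\mathbb{P}^1$ is the projectivization of the two-dimensional space of quadratic forms vanishing on $X$, and $X$ is the base locus of this pencil (as a set). Exactly five members of the pencil are singular, and each of them has exactly one singular point, its vertex. Say that a labelling $\lambda_1,\dots,\lambda_5\in\Lambda$ matches $p_1,\dots,p_5$ through the vertices if there are projective coordinates $(x_1:\dots:x_5)$ on $\mathbb{P}^4$ such that, for each $i$, the $i$-th coordinate vertex is a vertex of $Q_{\lambda_i}$, together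 with a map $\beta_0:X\to S^2C$ which is the restriction to $X$ of the squaring map $(x_1:\dots:x_5)\mapsto(x_1^2:\dots:x_5^2)$ followed by a projective linear map, such that $\beta_0^{-1}(t_i)=X\cap\{x_i=0\}$ for $i=1,\dots,5$. Such a labelling exists. For every such labelling, $\lambda_1,\dots,\lambda_5$ are distinct and are precisely the parameters of the singular quadrics of the pencil, and the bijection $\lambda_i\leftrightarrow p_i$ extends to a global isomorphism of projective lines $\iota:\Lambda\to C$, that is, $\iota(\lambda_i)=p_i$ for $i=1,\dots,5$. -/

import Mathlib

open scoped LinearAlgebra.Projectivization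

noncomputable section

namespace PencilOfQuadrics

/-- Projective `n`-space over `ℂ`; a point is a line in `ℂ^(n+1)`. -/
abbrev PSpace (n : ℕ) : Type := ℙ ℂ (Fin (n + 1) → ℂ)

/-! ### The curve `C = ℙ¹` and its symmetric square `S²C = ℙ²` -/

/-- The coefficients of the product of two binary linear forms. -/
def symMul (a b : Fin 2 → ℂ) : Fin 3 → ℂ :=
  ![a 0 * b 0, a 0 * b 1 + a 1 * b 0, a 1 * b 1]

theorem symMul_ne_zero {a b : Fin 2 → ℂ} (ha : a ≠ 0) (hb : b ≠ 0) : symMul a b ≠ 0 := by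
  intro h
  have h0 : a 0 * b 0 = 0 := by simpa [symMul] using congrFun h 0
  have h1 : a 0 * b 1 + a 1 * b 0 = 0 := by simpa [symMul] using congrFun h 1
  have h2 : a 1 * b 1 = 0 := by simpa [symMul] using congrFun h 2
  have key : (a 0 = 0 ∧ a 1 = 0) ∨ (b 0 = 0 ∧ b 1 = 0) := by
    rcases mul_eq_zero.mp h0 with h | h <;> rcases mul_eq_zero.mp h2 with h' | h' <;>
      simp_all
  rcases key with ⟨h, h'⟩ | ⟨h, h'⟩
  · exact ha (by ext i; fin_cases i <;> simp [h, h'])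
  · exact hb (by ext i; fin_cases i <;> simp [h, h'])

/-- The unordered pair `x + y`, as a point of `S²C = ℙ²`.  This is the quotient map
`C × C → S²C`. -/
def pairPoint (x y : PSpace 1) : PSpace 2 :=
  Projectivization.mk ℂ (symMul x.rep y.rep) (symMul_ne_zero x.rep_nonzero y.rep_nonzero)

/-- The diagonal embedding of `C` as a conic in `S²C`, `x ↦ 2x`. -/
def diag (x : PSpace 1) : PSpace 2 := pairPoint x x

/-- The line `x + C` in `S²C`: the tangent line of the diagonal conic at `diag x`. -/
def tangentLine (x : PSpace 1) : Set (PSpace 2) := Set.range (pairPoint x)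

/-! ### The anticanonically embedded blow-up of `S²C` at five points of the conic -/

/-- The linear system of plane cubics through the five points `p i` of the conic `C ⊂ S²C`.
It is `H⁰(X, -K_X)` for the blow-up `X` of `S²C` at these points. -/
def cubicsThrough (p : Fin 5 → PSpace 1) : Submodule ℂ (MvPolynomial (Fin 3) ℂ) where
  carrier := {f | f.IsHomogeneous 3 ∧ ∀ i, MvPolynomial.eval (diag (p i)).rep f = 0}
  add_mem' := by
    rintro f g ⟨hf, hf'⟩ ⟨hg, hg'⟩
    exact ⟨hf.add hg, fun i => by simp [hf' i, hg' i]⟩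
  zero_mem' := ⟨MvPolynomial.isHomogeneous_zero _ _ _, fun i => by simp⟩
  smul_mem' := by
    rintro a f ⟨hf, hf'⟩
    exact ⟨(MvPolynomial.homogeneousSubmodule (Fin 3) ℂ 3).smul_mem a hf,
      fun i => by simp [MvPolynomial.smul_eval, hf' i]⟩

/-- The Zariski closure of a subset of `ℙⁿ`. -/
def zariskiClosure {n : ℕ} (S : Set (PSpace n)) : Set (PSpace n) :=
  {y | ∀ (d : ℕ) (F : MvPolynomial (Fin (n + 1)) ℂ), F.IsHomogeneous d →
    (∀ z ∈ S, MvPolynomial.eval z.rep F = 0) → MvPolynomial.eval y.rep F = 0}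

/-- The map `ℂ³ → ℂ⁵` given by a basis of the linear system of cubics. -/
def cubicMap {p : Fin 5 → PSpace 1} (c : Module.Basis (Fin 5) ℂ (cubicsThrough p))
    (x : Fin 3 → ℂ) : Fin 5 → ℂ :=
  fun k => MvPolynomial.eval x (c k : MvPolynomial (Fin 3) ℂ)

/-- The quartic del Pezzo surface `X ⊂ ℙ⁴`: the image of the blow-up of `S²C` at the five points
under the anticanonical map, i.e. the closure of the image of `S²C ∖ {p i}` under the cubics
through the `p i`. -/
def delPezzo {p : Fin 5 → PSpace 1} (c : Module.Basis (Fin 5) ℂ (cubicsThrough p)) :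
    Set (PSpace 4) :=
  zariskiClosure {y | ∃ (x : Fin 3 → ℂ) (h : cubicMap c x ≠ 0),
    y = Projectivization.mk ℂ (cubicMap c x) h}

/-! ### The pencil of quadrics -/

/-- The space of quadratic forms on `ℂ⁵` vanishing on `S ⊂ ℙ⁴`. -/
def quadricsThrough (S : Set (PSpace 4)) : Submodule ℂ (QuadraticForm ℂ (Fin 5 → ℂ)) where
  carrier := {q | ∀ y ∈ S, q y.rep = 0}
  add_mem' := by
    intro a b ha hb y hy
    simp [ha y hy, hb y hy]
  zero_mem' := by
    intro y _
    simp
  smul_mem' := by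
    intro r a ha y hy
    simp [ha y hy]

/-- The parameter space `Λ` of the linear system of quadrics through `S`. -/
abbrev ParameterSpace (S : Set (PSpace 4)) : Type := ℙ ℂ (quadricsThrough S)

/-- The quadratic form (up to scalar) `Q_l` with parameter `l`. -/
def member {S : Set (PSpace 4)} (l : ParameterSpace S) : QuadraticForm ℂ (Fin 5 → ℂ) :=
  (l.rep : QuadraticForm ℂ (Fin 5 → ℂ))

/-- `v` is a singular point of the quadric `Q_l`: it is orthogonal to everything. -/
def IsVertex {S : Set (PSpace 4)} (l : ParameterSpace S) (v : PSpace 4) : Prop :=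
  ∀ w, QuadraticMap.polar (member l) v.rep w = 0

/-- The set of parameters of the singular quadrics. -/
def singularMembers (S : Set (PSpace 4)) : Set (ParameterSpace S) :=
  {l | ∃ v, IsVertex l v}

/-- The point of `ℙ⁴` given by a vector of a basis. -/
def basisPoint (e : Module.Basis (Fin 5) ℂ (Fin 5 → ℂ)) (i : Fin 5) : PSpace 4 :=
  Projectivization.mk ℂ (e i) (e.ne_zero i)

/-- `β : S → S²C` is, in the coordinates `x i` of `e`, the squaring map
`(x₁ : … : x₅) ↦ (x₁² : … : x₅²)` followed by a linear map, and the `i`-th branch line (the image of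
`x i = 0`) is the line tangent to `C` at `p i`. -/
def IsSquaringCover (p : Fin 5 → PSpace 1) (S : Set (PSpace 4))
    (e : Module.Basis (Fin 5) ℂ (Fin 5 → ℂ)) (β : S → PSpace 2) : Prop :=
  (∃ g : (Fin 5 → ℂ) →ₗ[ℂ] (Fin 3 → ℂ), ∀ y : S,
    ∃ h : g (fun i => e.repr y.1.rep i ^ 2) ≠ 0, β y = Projectivization.mk ℂ _ h) ∧
  ∀ i, β ⁻¹' tangentLine (p i) = {y | e.repr y.1.rep i = 0}

/-- The labelling `l i ↔ p i` arises by matching both sides with the vertices of the singular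
quadrics: there are projective coordinates on `ℙ⁴` whose `i`-th coordinate vertex is the vertex
of `Q_(l i)`, and a squaring cover `β : S → S²C` in these coordinates whose `i`-th branch line is
the tangent line to `C` at `p i`. -/
def IsVertexMatching (p : Fin 5 → PSpace 1) (S : Set (PSpace 4))
    (l : Fin 5 → ParameterSpace S) : Prop :=
  ∃ e : Module.Basis (Fin 5) ℂ (Fin 5 → ℂ), (∀ i, IsVertex (l i) (basisPoint e i)) ∧
    ∃ β : S → PSpace 2, IsSquaringCover p S e β

/-- Isomorphisms of projective spaces: the maps induced by linear isomorphisms. -/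
def IsProjectiveIso {V W : Type*} [AddCommGroup V] [Module ℂ V] [AddCommGroup W] [Module ℂ W]
    (ι : ℙ ℂ V → ℙ ℂ W) : Prop :=
  ∃ f : V ≃ₗ[ℂ] W, ι = Projectivization.map f.toLinearMap f.injective

end PencilOfQuadrics

end

noncomputable section

namespace PencilOfQuadrics

/-! ### Binary forms -/

/-! Identify linear forms on `ℂ²` with vectors through the bracket, and points of `S²C` with binary
quadratic forms. Choose representatives `a i` of the points. Five points on a line carry one
relation `ω` with all weights nonzero, orthogonal to all cubic forms (`exists_isWeighted`). For the
pairing weighted by `ω`, the values at the `a i` of linear forms and of quadratic forms are each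
other's orthogonal complements. The model surface is the base locus `B` of the diagonal pencil `∑ ωᵢ
g(aᵢ) vᵢ²`, with `g` a linear form. By duality, `v` lies in `B` exactly when the squares `vᵢ²` are
the values of a quadratic form `z`; then `v ↦ z` is a squaring cover whose branch lines are the
tangents at the `p i`, and the member `g` is singular exactly when `g` vanishes at some `a i`.

`B` is the del Pezzo surface: it contains the line `lin a`, and projecting from that line is
birational onto the plane, with inverse `param` given by cubics through the `p i`. These span the
linear system, so any anticanonical embedding differs from the model by a linear map `T`
(`exists_linearEquiv_param`). Sign changes reach the points where the projection degenerates
(`mem_delPezzo_iff`), and they force every quadric through `B` to be diagonal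
(`exists_eq_br_pencil`).

For an arbitrary matching, the vertices fix the coordinates up to a permutation `σ` and scaling, and
the cover induces a projectivity of the plane carrying the tangent line at `p (σ i)` to the one at
`p i`. The linear relations among the five tangent forms are `(ωᵢ g(aᵢ))`, indexed by linear forms
`g`; transporting them gives a projectivity of the line carrying `p (σ i)` to `p i`
(`exists_linearEquiv_of_tang`). Composed with the parametrization of the pencil by `g`, it is `ι`.
-/

/-- The bracket of two vectors of the plane. -/
def br (u v : Fin 2 → ℂ) : ℂ := u 0 * v 1 - u 1 * v 0

/-- The value at `u` of the binary quadratic form with coefficients `z`; it vanishes exactly on the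
tangent line at `u` of the diagonal conic. -/
def tang (u : Fin 2 → ℂ) : (Fin 3 → ℂ) →ₗ[ℂ] ℂ where
  toFun z := z 0 * u 1 ^ 2 - z 1 * (u 0 * u 1) + z 2 * u 0 ^ 2
  map_add' x y := by simp; ring
  map_smul' r x := by simp; ring

theorem tang_apply (u : Fin 2 → ℂ) (z : Fin 3 → ℂ) :
    tang u z = z 0 * u 1 ^ 2 - z 1 * (u 0 * u 1) + z 2 * u 0 ^ 2 := rfl

theorem tang_symMul (u v w : Fin 2 → ℂ) : tang u (symMul v w) = br v u * br w u := by
  simp [tang_apply, symMul, br]; ring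

theorem br_self (u : Fin 2 → ℂ) : br u u = 0 := by simp [br]; ring

theorem br_swap (u v : Fin 2 → ℂ) : br u v = -br v u := by simp [br]; ring

theorem exists_smul_of_br_eq_zero {u v : Fin 2 → ℂ} (hv : v ≠ 0) (h : br u v = 0) :
    ∃ r : ℂ, u = r • v := by
  have h' : u 0 * v 1 = u 1 * v 0 := sub_eq_zero.mp h
  by_cases h0 : v 0 = 0
  · have h1 : v 1 ≠ 0 := fun h1 => hv (by ext i; fin_cases i <;> simp [h0, h1])
    refine ⟨u 1 / v 1, ?_⟩
    ext i
    fin_cases i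
    · simp only [h0, mul_zero, mul_eq_zero, h1, or_false] at h'
      simp [h0, h']
    · simp [h1]
  · refine ⟨u 0 / v 0, ?_⟩
    ext i
    fin_cases i
    · simp [h0]
    · simp only [Fin.mk_one, Pi.smul_apply, smul_eq_mul]
      field_simp
      linear_combination -h'

/-- The discriminant of a binary quadratic form, the equation of the diagonal conic. -/
def disc (q : Fin 3 → ℂ) : ℂ := q 0 * q 2 - q 1 ^ 2 / 4

/-- The traceless endomorphism of the plane attached to a binary quadratic form. -/
def polarMap (q : Fin 3 → ℂ) (f : Fin 2 → ℂ) : Fin 2 → ℂ :=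
  ![f 0 * (q 1 / 2) - f 1 * q 0, f 0 * q 2 - f 1 * (q 1 / 2)]

/-- Cayley–Hamilton for a traceless endomorphism of determinant `disc q`. This makes `polarMap q`
invertible off the conic and lets the projection be inverted. -/
theorem polarMap_polarMap (q : Fin 3 → ℂ) (f : Fin 2 → ℂ) :
    polarMap q (polarMap q f) = (-disc q) • f := by
  ext i; fin_cases i <;> simp [polarMap, disc] <;> ring

theorem polarMap_smul (q : Fin 3 → ℂ) (r : ℂ) (f : Fin 2 → ℂ) :
    polarMap q (r • f) = r • polarMap q f := by
  ext i; fin_cases i <;> simp [polarMap] <;> ring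

theorem polarMap_symMul_self (u f : Fin 2 → ℂ) : polarMap (symMul u u) f = br f u • u := by
  ext i; fin_cases i <;> simp [polarMap, symMul, br] <;> ring

theorem disc_symMul_self (u : Fin 2 → ℂ) : disc (symMul u u) = 0 := by
  simp [disc, symMul]; ring

/-- A binary quadratic form with root `u` is divisible by the linear form vanishing at `u`. -/
theorem exists_symMul_of_tang_eq_zero {u : Fin 2 → ℂ} (hu : u ≠ 0) {z : Fin 3 → ℂ}
    (h : tang u z = 0) : ∃ v, z = symMul u v := by
  rw [tang_apply] at h
  by_cases h0 : u 0 = 0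
  · have h1 : u 1 ≠ 0 := fun h1 => hu (by ext i; fin_cases i <;> simp [h0, h1])
    refine ⟨![z 1 / u 1, z 2 / u 1], ?_⟩
    have hz : z 0 = 0 := by simpa [h0, h1] using h
    ext i
    fin_cases i <;> simp [symMul, h0, hz] <;> field_simp
  · refine ⟨![z 0 / u 0, (z 1 - z 0 / u 0 * u 1) / u 0], ?_⟩
    ext i
    fin_cases i
    · simp [symMul]; field_simp
    · simp [symMul]; field_simp; ring
    · simp [symMul]; field_simp; linear_combination h

theorem mem_tangentLine_iff (x : PSpace 1) (y : PSpace 2) :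
    y ∈ tangentLine x ↔ tang x.rep y.rep = 0 := by
  constructor
  · rintro ⟨b, rfl⟩
    obtain ⟨r, hr⟩ := Projectivization.exists_smul_eq_mk_rep ℂ (symMul x.rep b.rep)
      (symMul_ne_zero x.rep_nonzero b.rep_nonzero)
    rw [pairPoint, ← hr, Units.smul_def, map_smul, tang_symMul, br_self]
    simp
  · intro h
    obtain ⟨v, hv⟩ := exists_symMul_of_tang_eq_zero x.rep_nonzero h
    have hv0 : v ≠ 0 := by
      rintro rfl
      apply y.rep_nonzero
      rw [hv]
      ext i; fin_cases i <;> simp [symMul]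
    refine ⟨Projectivization.mk ℂ v hv0, ?_⟩
    obtain ⟨r, hr⟩ := Projectivization.exists_smul_eq_mk_rep ℂ v hv0
    rw [← y.mk_rep, pairPoint, Projectivization.mk_eq_mk_iff']
    refine ⟨r, ?_⟩
    rw [hv, ← hr, Units.smul_def]
    ext i; fin_cases i <;> simp [symMul] <;> ring

theorem tang_mk_rep_eq_zero_iff (u : Fin 2 → ℂ) {z : Fin 3 → ℂ} (hz : z ≠ 0) :
    tang u (Projectivization.mk ℂ z hz).rep = 0 ↔ tang u z = 0 := by
  obtain ⟨r, hr⟩ := Projectivization.exists_smul_eq_mk_rep ℂ z hz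
  rw [← hr, Units.smul_def, map_smul, smul_eq_mul, mul_eq_zero, or_iff_right r.ne_zero]

/-! ### Five points of the line and the weights of their Gale dual -/

/-- Five points of the projective line, with the weights `ω` of the linear relation between their
images under the third Veronese map. -/
structure IsWeighted (a : Fin 5 → Fin 2 → ℂ) (ω : Fin 5 → ℂ) : Prop where
  br_ne : ∀ i j, i ≠ j → br (a i) (a j) ≠ 0
  ne_zero : ∀ i, ω i ≠ 0
  rel : ∀ z h, ∑ i, ω i * (tang (a i) z * br h (a i)) = 0

/-- Five vectors in the four-dimensional space of cubic monomials are dependent. If one weight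
vanished, a cubic with roots at three of the other four points would isolate the last weight, so all
weights would vanish. -/
theorem exists_isWeighted {a : Fin 5 → Fin 2 → ℂ} (ha : ∀ i j, i ≠ j → br (a i) (a j) ≠ 0) :
    ∃ ω, IsWeighted a ω := by
  let φ : (Fin 5 → ℂ) →ₗ[ℂ] (Fin 4 → ℂ) :=
    (Matrix.of fun (k : Fin 4) (i : Fin 5) => a i 0 ^ (k : ℕ) * a i 1 ^ (3 - (k : ℕ))).mulVecLin
  obtain ⟨ω, hω, hne⟩ := (Submodule.ne_bot_iff _).mp
    (LinearMap.ker_ne_bot_of_finrank_lt (f := φ) (by simp))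
  have hφ : ∀ k : Fin 4, ∑ i, a i 0 ^ (k : ℕ) * a i 1 ^ (3 - (k : ℕ)) * ω i = 0 := fun k => by
    have := congrFun (LinearMap.mem_ker.mp hω) k
    simpa [φ, Matrix.mulVec, dotProduct] using this
  have hrel : ∀ z h, ∑ i, ω i * (tang (a i) z * br h (a i)) = 0 := by
    intro z h
    have h0 := hφ 0
    have h1 := hφ 1
    have h2 := hφ 2
    have h3 := hφ 3
    simp only [Fin.sum_univ_five, Fin.isValue, Fin.val_zero, Fin.val_one, Fin.val_two,
      show ((3 : Fin 4) : ℕ) = 3 from rfl] at h0 h1 h2 h3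
    simp only [Fin.sum_univ_five, tang_apply, br]
    linear_combination (h 0 * z 0) * h0 - (h 1 * z 0 + h 0 * z 1) * h1
      + (h 1 * z 1 + h 0 * z 2) * h2 - h 1 * z 2 * h3
  refine ⟨ω, ha, fun i hi => ?_, hrel⟩
  obtain ⟨j, hj⟩ := Function.ne_iff.mp hne
  have hji : j ≠ i := fun h => hj (h ▸ hi)
  obtain ⟨k, l, m, hk, hl, hm, hall⟩ : ∃ k l m : Fin 5, k ≠ j ∧ l ≠ j ∧ m ≠ j ∧
      ∀ n, n = j ∨ n = i ∨ n = k ∨ n = l ∨ n = m := by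
    clear hrel hφ hω hne hj hi φ ha
    revert i j
    decide
  have := hrel (symMul (a k) (a l)) (a m)
  rw [Finset.sum_eq_single j] at this
  · rw [tang_symMul] at this
    simp only [mul_eq_zero, ha _ _ hk, ha _ _ hl, ha _ _ hm, or_false] at this
    exact hj this
  · intro n _ hn
    rw [tang_symMul]
    rcases hall n with rfl | rfl | rfl | rfl | rfl
    · exact absurd rfl hn
    · simp [hi]
    all_goals simp [br_self]
  · simp

/-- The values of a linear form at the five points. -/
def lin (a : Fin 5 → Fin 2 → ℂ) : (Fin 2 → ℂ) →ₗ[ℂ] (Fin 5 → ℂ) where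
  toFun g i := br g (a i)
  map_add' x y := by ext; simp [br]; ring
  map_smul' r x := by ext; simp [br]; ring

/-- The values of a quadratic form at the five points. -/
def quad (a : Fin 5 → Fin 2 → ℂ) : (Fin 3 → ℂ) →ₗ[ℂ] (Fin 5 → ℂ) :=
  LinearMap.pi fun i => tang (a i)

theorem lin_apply (a : Fin 5 → Fin 2 → ℂ) (g i) : lin a g i = br g (a i) := rfl

theorem quad_apply (a : Fin 5 → Fin 2 → ℂ) (z i) : quad a z i = tang (a i) z := rfl

/-- The projection of `ℙ⁴` from the line `lin a`. -/
def proj (a : Fin 5 → Fin 2 → ℂ) (ω : Fin 5 → ℂ) : (Fin 5 → ℂ) →ₗ[ℂ] (Fin 3 → ℂ) where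
  toFun v := ∑ i, (ω i * v i) • symMul (a i) (a i)
  map_add' x y := by simp [mul_add, add_smul, Finset.sum_add_distrib]
  map_smul' r x := by simp [Finset.smul_sum, smul_smul, mul_left_comm]

/-- The pencil of quadrics `∑ ωᵢ f(aᵢ) vᵢ²`, as a map to the plane. -/
def pencil (a : Fin 5 → Fin 2 → ℂ) (ω : Fin 5 → ℂ) (v : Fin 5 → ℂ) : Fin 2 → ℂ :=
  ∑ i, (ω i * v i ^ 2) • a i

theorem proj_apply (a : Fin 5 → Fin 2 → ℂ) (ω v) :
    proj a ω v = ∑ i, (ω i * v i) • symMul (a i) (a i) := rfl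

theorem pencil_smul (a : Fin 5 → Fin 2 → ℂ) (ω v) (r : ℂ) :
    pencil a ω (r • v) = r ^ 2 • pencil a ω v := by
  simp only [pencil, Pi.smul_apply, smul_eq_mul, Finset.smul_sum, smul_smul]
  exact Finset.sum_congr rfl fun i _ => by ring_nf

theorem br_pencil (a : Fin 5 → Fin 2 → ℂ) (ω v g) :
    br g (pencil a ω v) = ∑ i, ω i * br g (a i) * v i ^ 2 := by
  simp only [pencil, br, Fin.sum_univ_five, Pi.add_apply, Pi.smul_apply, smul_eq_mul]
  ring

theorem eq_zero_of_br_eq_zero {v : Fin 2 → ℂ} (h : ∀ g, br g v = 0) : v = 0 := by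
  have h0 := h ![0, 1]
  have h1 := h ![1, 0]
  simp [br] at h0 h1
  ext i; fin_cases i <;> simp [h0, h1]

namespace IsWeighted

variable {a : Fin 5 → Fin 2 → ℂ} {ω : Fin 5 → ℂ} (h : IsWeighted a ω)
include h

theorem point_ne_zero (i : Fin 5) : a i ≠ 0 := by
  intro h0
  obtain ⟨j, hj⟩ : ∃ j : Fin 5, i ≠ j := exists_ne i |>.imp fun _ => Ne.symm
  exact h.br_ne i j hj (by simp [h0, br])

theorem lin_injective : Function.Injective (lin a) := by
  rw [injective_iff_map_eq_zero]
  intro g hg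
  obtain ⟨r, hr⟩ := exists_smul_of_br_eq_zero (h.point_ne_zero 0) (congrFun hg 0)
  have h1 := congrFun hg 1
  rw [hr, map_smul] at h1
  have : r = 0 := by simpa [lin_apply, h.br_ne 0 1 (by decide)] using h1
  rw [hr, this, zero_smul]

/-- A binary quadratic form with more than two roots is zero. -/
theorem quad_injective : Function.Injective (quad a) := by
  rw [injective_iff_map_eq_zero]
  intro z hz
  obtain ⟨v, hv⟩ := exists_symMul_of_tang_eq_zero (h.point_ne_zero 0) (congrFun hz 0)
  have hbr : ∀ i, i ≠ 0 → br v (a i) = 0 := fun i hi => by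
    have := congrFun hz i
    rw [quad_apply, hv, tang_symMul] at this
    simpa [h.br_ne 0 i hi.symm] using this
  obtain ⟨r, hr⟩ := exists_smul_of_br_eq_zero (h.point_ne_zero 1) (hbr 1 (by decide))
  have h2 := hbr 2 (by decide)
  have : r = 0 := by
    rw [hr, show r • a 1 = ![r * a 1 0, r * a 1 1] by ext i; fin_cases i <;> simp] at h2
    have h3 : r * br (a 1) (a 2) = 0 := by rw [← h2]; simp [br]; ring
    simpa [h.br_ne 1 2 (by decide)] using h3
  rw [hv, hr, this]
  ext i; fin_cases i <;> simp [symMul]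

theorem proj_lin (g : Fin 2 → ℂ) : proj a ω (lin a g) = 0 := by
  have h0 := h.rel ![1, 0, 0] g
  have h1 := h.rel ![0, 1, 0] g
  have h2 := h.rel ![0, 0, 1] g
  simp only [Fin.sum_univ_five, tang_apply] at h0 h1 h2
  simp at h0 h1 h2
  ext i
  simp only [proj_apply, lin_apply, Fin.sum_univ_five, Pi.add_apply, Pi.smul_apply, smul_eq_mul,
    Pi.zero_apply]
  fin_cases i <;> simp [symMul]
  · linear_combination h2
  · linear_combination -2 * h1
  · linear_combination h0

/-- The values orthogonal to all quadratic forms are those of the linear forms. -/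
theorem exists_lin_of_sum_eq_zero {x : Fin 5 → ℂ}
    (hx : ∀ z, ∑ i, ω i * (tang (a i) z * x i) = 0) : ∃ g, x = lin a g := by
  have h01 := h.br_ne 0 1 (by decide)
  -- The linear form interpolating `x` at the first two points. At a third point, agreement follows
  -- by testing the orthogonality on the quadratic form with roots at the remaining two.
  let g : Fin 2 → ℂ := (br (a 0) (a 1))⁻¹ • (x 1 • a 0 - x 0 • a 1)
  have hg : ∀ i, lin a g i = (br (a 0) (a 1))⁻¹ * (x 1 * br (a 0) (a i) - x 0 * br (a 1) (a i)) :=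
    fun i => by simp [g, lin_apply, br]; ring
  have hg0 : lin a g 0 = x 0 := by
    rw [hg, br_self, br_swap (a 1) (a 0)]; field_simp; ring
  have hg1 : lin a g 1 = x 1 := by
    rw [hg, br_self]; field_simp; ring
  have hsub : ∀ z, ∑ i, ω i * (tang (a i) z * (x i - lin a g i)) = 0 := fun z => by
    simp only [mul_sub, Finset.sum_sub_distrib]
    rw [hx, zero_sub, neg_eq_zero]
    exact h.rel z g
  have key : ∀ i j k : Fin 5, i ≠ j → i ≠ k → (∀ n, n = 0 ∨ n = 1 ∨ n = i ∨ n = j ∨ n = k) →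
      x i = lin a g i := by
    intro i j k hj hk hall
    have := hsub (symMul (a j) (a k))
    rw [Finset.sum_eq_single i] at this
    · simp only [tang_symMul, mul_eq_zero, h.ne_zero, h.br_ne _ _ hj.symm, h.br_ne _ _ hk.symm,
        false_or, sub_eq_zero] at this
      exact this
    · intro n _ hn
      rcases hall n with rfl | rfl | rfl | rfl | rfl
      · simp [hg0]
      · simp [hg1]
      · exact absurd rfl hn
      all_goals simp [tang_symMul, br_self]
    · simp
  refine ⟨g, ?_⟩
  ext i
  fin_cases i
  · exact hg0.symm
  · exact hg1.symm
  · exact key 2 3 4 (by decide) (by decide) (by decide)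
  · exact key 3 2 4 (by decide) (by decide) (by decide)
  · exact key 4 2 3 (by decide) (by decide) (by decide)

theorem exists_lin_of_proj_eq_zero {x : Fin 5 → ℂ} (hx : proj a ω x = 0) : ∃ g, x = lin a g := by
  refine h.exists_lin_of_sum_eq_zero fun z => ?_
  have h0 := congrFun hx 0
  have h1 := congrFun hx 1
  have h2 := congrFun hx 2
  simp only [proj_apply, Fin.sum_univ_five, Pi.add_apply, Pi.smul_apply, smul_eq_mul, symMul,
    Pi.zero_apply] at h0 h1 h2
  simp at h0 h1 h2
  simp only [Fin.sum_univ_five, tang_apply]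
  linear_combination z 0 * h2 - z 1 * h1 / 2 + z 2 * h0

theorem proj_surjective : Function.Surjective (proj a ω) := by
  have hker : LinearMap.ker (proj a ω) = LinearMap.range (lin a) := by
    ext x
    constructor
    · intro hx
      obtain ⟨g, rfl⟩ := h.exists_lin_of_proj_eq_zero hx
      exact ⟨g, rfl⟩
    · rintro ⟨g, rfl⟩
      exact h.proj_lin g
  have hk : Module.finrank ℂ (LinearMap.ker (proj a ω)) = 2 := by
    rw [hker, LinearMap.finrank_range_of_inj h.lin_injective]; simp
  have := (proj a ω).finrank_range_add_finrank_ker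
  rw [hk] at this
  rw [← LinearMap.range_eq_top]
  apply Submodule.eq_top_of_finrank_eq
  simp at this ⊢
  omega

omit h in
theorem sum_polarMap (v : Fin 5 → ℂ) (f : Fin 2 → ℂ) :
    ∑ i, (ω i * v i * br f (a i)) • a i = polarMap (proj a ω v) f := by
  ext i
  fin_cases i <;> simp [polarMap, proj_apply, symMul, br, Fin.sum_univ_five] <;> ring

/-- Paired with `g`, this is the relation `ω` applied to the cubic `g z`. -/
theorem pencil_quad_sqrt {v : Fin 5 → ℂ} {z : Fin 3 → ℂ} (hv : ∀ i, v i ^ 2 = tang (a i) z) :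
    pencil a ω v = 0 := by
  apply eq_zero_of_br_eq_zero
  intro g
  rw [br_pencil, ← h.rel z g]
  exact Finset.sum_congr rfl fun i _ => by rw [hv]; ring

theorem pencil_lin (f : Fin 2 → ℂ) : pencil a ω (lin a f) = 0 :=
  h.pencil_quad_sqrt (z := symMul f f) fun i => by rw [tang_symMul, lin_apply]; ring

theorem exists_quad_of_pencil_eq_zero {v : Fin 5 → ℂ} (hv : pencil a ω v = 0) :
    ∃ z, ∀ i, v i ^ 2 = tang (a i) z := by
  -- Lagrange interpolation of the squares at the first three points. The error is then supported at
  -- the last two, where testing against `a 4` and `a 3` isolates one term each.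
  let z : Fin 3 → ℂ :=
    (v 0 ^ 2 / (br (a 1) (a 0) * br (a 2) (a 0))) • symMul (a 1) (a 2) +
    (v 1 ^ 2 / (br (a 0) (a 1) * br (a 2) (a 1))) • symMul (a 0) (a 2) +
    (v 2 ^ 2 / (br (a 0) (a 2) * br (a 1) (a 2))) • symMul (a 0) (a 1)
  have hb := h.br_ne
  have h0 : v 0 ^ 2 = tang (a 0) z := by
    simp [z, tang_symMul, br_self, hb]
  have h1 : v 1 ^ 2 = tang (a 1) z := by
    simp [z, tang_symMul, br_self, hb]
  have h2 : v 2 ^ 2 = tang (a 2) z := by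
    simp [z, tang_symMul, br_self, hb]
  have hsub : ∀ g, ∑ i, ω i * br g (a i) * (v i ^ 2 - tang (a i) z) = 0 := fun g => by
    simp only [mul_sub, Finset.sum_sub_distrib]
    have hz : ∑ i, ω i * br g (a i) * tang (a i) z = 0 :=
      (Finset.sum_congr rfl fun i _ => by ring).trans (h.rel z g)
    rw [← br_pencil, hv, hz]
    simp [br]
  refine ⟨z, fun i => ?_⟩
  have h3 := hsub (a 4)
  have h4 := hsub (a 3)
  simp only [Fin.sum_univ_five, h0, h1, h2, sub_self, br_self, mul_zero, zero_mul, add_zero,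
    zero_add, mul_eq_zero, h.ne_zero, hb 4 3 (by decide), hb 3 4 (by decide), or_self, false_or,
    sub_eq_zero] at h3 h4
  fin_cases i <;> assumption

/-- The term quadratic in `f` drops out because the line `lin a` lies in the base locus; the cross
term depends on `v` only through its projection. -/
theorem pencil_add_lin (v : Fin 5 → ℂ) (f : Fin 2 → ℂ) :
    pencil a ω (v + lin a f) = pencil a ω v + (2 : ℂ) • polarMap (proj a ω v) f := by
  have := h.pencil_lin f
  rw [← sum_polarMap, ← add_zero (pencil a ω v + _), ← this]
  simp only [pencil, Finset.smul_sum, ← Finset.sum_add_distrib]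
  refine Finset.sum_congr rfl fun i _ => ?_
  simp only [smul_smul, ← add_smul, Pi.add_apply, lin_apply]
  congr 1
  ring

end IsWeighted

/-! ### Sign changes -/

/-- The sign change of the coordinates in `G`. -/
def flip (G : Finset (Fin 5)) : (Fin 5 → ℂ) →ₗ[ℂ] (Fin 5 → ℂ) where
  toFun v i := if i ∈ G then -v i else v i
  map_add' x y := by ext i; by_cases hi : i ∈ G <;> simp [hi]; ring
  map_smul' r x := by ext i; by_cases hi : i ∈ G <;> simp [hi]

theorem flip_apply (G : Finset (Fin 5)) (v : Fin 5 → ℂ) (i) :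
    flip G v i = if i ∈ G then -v i else v i := rfl

theorem flip_flip (G H : Finset (Fin 5)) (v : Fin 5 → ℂ) :
    flip G (flip H v) = flip (symmDiff G H) v := by
  ext i
  by_cases hG : i ∈ G <;> by_cases hH : i ∈ H <;> simp [flip_apply, Finset.mem_symmDiff, hG, hH]

theorem flip_flip_self (G : Finset (Fin 5)) (v : Fin 5 → ℂ) : flip G (flip G v) = v := by
  rw [flip_flip, symmDiff_self]; ext; simp [flip_apply]

theorem pencil_flip (a : Fin 5 → Fin 2 → ℂ) (ω G v) : pencil a ω (flip G v) = pencil a ω v := by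
  refine Finset.sum_congr rfl fun i _ => ?_
  rw [flip_apply]
  split_ifs <;> simp

theorem flip_eq_sub (G : Finset (Fin 5)) (v : Fin 5 → ℂ) :
    flip G v = v - (2 : ℂ) • ∑ i ∈ G, Pi.single i (v i) := by
  ext i
  simp only [flip_apply, Pi.sub_apply, Pi.smul_apply, Finset.sum_apply, Pi.single_apply,
    Finset.sum_ite_eq, smul_eq_mul]
  split_ifs <;> ring

/-- The mixed Fourier coefficient of a quadratic form with respect to sign changes. -/
theorem map_flip_alternating_sum (q : QuadraticForm ℂ (Fin 5 → ℂ)) {i j : Fin 5} (hij : i ≠ j)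
    (v : Fin 5 → ℂ) :
    q (flip ∅ v) - q (flip {i} v) - q (flip {j} v) + q (flip {i, j} v) =
      4 * (v i * v j) * QuadraticMap.polar q (Pi.single i 1) (Pi.single j 1) := by
  have hs : ∀ k, (Pi.single k (v k) : Fin 5 → ℂ) = v k • Pi.single k 1 := fun k => by
    rw [← Pi.single_smul, smul_eq_mul, mul_one]
  have hsub : ∀ x : Fin 5 → ℂ, q (v - (2 : ℂ) • x) =
      q v + 4 * q x - 2 * QuadraticMap.polar q v x := fun x => by
    rw [sub_eq_add_neg, ← neg_smul, QuadraticMap.map_add q, QuadraticMap.map_smul,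
      QuadraticMap.polar_smul_right]
    simp only [smul_eq_mul]; ring
  simp only [flip_eq_sub, hsub, Finset.sum_empty, Finset.sum_singleton, Finset.sum_pair hij,
    QuadraticMap.polar_add_right, QuadraticMap.map_add q, hs, QuadraticMap.polar_smul_left,
    QuadraticMap.polar_smul_right, smul_eq_mul, QuadraticMap.map_zero, QuadraticMap.polar_zero_right]
  ring

/-- The discriminant as a quadratic form. -/
def discForm : QuadraticForm ℂ (Fin 3 → ℂ) :=
  QuadraticMap.linMulLin (LinearMap.proj 0) (LinearMap.proj 2) -
    (1 / 4 : ℂ) • QuadraticMap.linMulLin (LinearMap.proj 1) (LinearMap.proj 1)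

theorem discForm_apply (q : Fin 3 → ℂ) : discForm q = disc q := by
  simp [discForm, disc]; ring

theorem disc_smul (r : ℂ) (q : Fin 3 → ℂ) : disc (r • q) = r ^ 2 * disc q := by
  simp [disc]; ring

theorem disc_combination (u v : Fin 2 → ℂ) (r s : ℂ) :
    disc (r • symMul u u + s • symMul v v) = r * s * br u v ^ 2 := by
  simp [disc, symMul, br]; ring

/-! ### Moving points of the base locus off the conic by sign changes -/

namespace IsWeighted

variable {a : Fin 5 → Fin 2 → ℂ} {ω : Fin 5 → ℂ} (h : IsWeighted a ω)
include h

theorem eq_zero_of_pencil_eq_zero {v : Fin 5 → ℂ} (hv : pencil a ω v = 0)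
    (h0 : ∀ i j, i ≠ j → v i * v j = 0) : v = 0 := by
  by_contra hne
  obtain ⟨i, hi⟩ := Function.ne_iff.mp hne
  have hj : ∀ j, j ≠ i → v j = 0 := fun j hj => by
    have := h0 i j hj.symm
    simpa [show v i ≠ 0 from hi] using this
  rw [pencil, Finset.sum_eq_single i (fun j _ hji => by simp [hj j hji]) (by simp)] at hv
  simp [h.ne_zero, h.point_ne_zero] at hv
  exact hi hv

omit h in
theorem proj_single (i : Fin 5) (r : ℂ) :
    proj a ω (Pi.single i r) = (ω i * r) • symMul (a i) (a i) := by
  rw [proj_apply, Finset.sum_eq_single i (fun j _ hji => by simp [hji]) (by simp)]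
  simp

/-- If `disc ∘ proj` vanished on the whole orbit of `v`, its mixed Fourier coefficients would give
`v i * v j = 0` for `i ≠ j`. A point of the base locus cannot have a single nonzero coordinate. -/
theorem exists_flip_disc_ne_zero {v : Fin 5 → ℂ} (hv : pencil a ω v = 0) (hne : v ≠ 0) :
    ∃ G, disc (proj a ω (flip G v)) ≠ 0 := by
  by_contra! hall
  refine hne (h.eq_zero_of_pencil_eq_zero hv fun i j hij => ?_)
  have key := map_flip_alternating_sum (discForm.comp (proj a ω)) hij v
  simp only [QuadraticMap.comp_apply, discForm_apply, hall, sub_self, add_zero] at key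
  have hp : QuadraticMap.polar (discForm.comp (proj a ω)) (Pi.single i 1) (Pi.single j 1) =
      ω i * ω j * br (a i) (a j) ^ 2 := by
    rw [QuadraticMap.polar]
    simp only [QuadraticMap.comp_apply, discForm_apply, map_add, proj_single, mul_one, disc_smul,
      disc_symMul_self, disc_combination]
    ring
  rw [hp] at key
  have := h.ne_zero i
  have := h.ne_zero j
  have := h.br_ne i j hij
  simp_all

theorem disc_flip_lin {f : Fin 2 → ℂ} (hf : ∀ i, br f (a i) ≠ 0) {S : Finset (Fin 5)}
    (hS : S.card = 2 ∨ S.card = 3) : disc (proj a ω (flip S (lin a f))) ≠ 0 := by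
  have hpair : ∀ S : Finset (Fin 5), S.card = 2 → disc (proj a ω (flip S (lin a f))) ≠ 0 := by
    intro S hS
    obtain ⟨i, j, hij, rfl⟩ := Finset.card_eq_two.mp hS
    rw [flip_eq_sub, map_sub, h.proj_lin, map_smul, Finset.sum_pair hij, map_add, proj_single,
      proj_single, zero_sub, ← neg_smul, disc_smul, disc_combination]
    simp [h.ne_zero, h.br_ne i j hij, lin_apply, hf]
  rcases hS with hS | hS
  · exact hpair S hS
  -- Changing the signs in `S` or in its complement gives the same projective point, which reduces
  -- three signs to two.
  · have : flip S (lin a f) = (-1 : ℂ) • flip Sᶜ (lin a f) := by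
      ext i
      by_cases hi : i ∈ S <;> simp [flip_apply, hi]
    rw [this, map_smul, disc_smul]
    simpa using hpair Sᶜ (by rw [Finset.card_compl, hS]; rfl)

omit h in
theorem exists_symmDiff_card (G : Finset (Fin 5)) : ∃ S : Finset (Fin 5),
    (S.card = 2 ∨ S.card = 3) ∧ ((symmDiff G S).card = 2 ∨ (symmDiff G S).card = 3) := by
  revert G
  decide

theorem exists_br_ne_zero : ∃ f, ∀ i, br f (a i) ≠ 0 := by
  have hinj : ∀ i, {t : ℂ | br ![1, t] (a i) = 0}.Subsingleton := by
    intro i s hs t ht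
    simp only [br, Set.mem_ofPred_eq, Matrix.cons_val_zero, Matrix.cons_val_one] at hs ht
    by_contra hst
    have h0 : a i 0 = 0 := by
      have : (s - t) * a i 0 = 0 := by linear_combination ht - hs
      simpa [sub_ne_zero.mpr hst] using this
    refine h.point_ne_zero i ?_
    ext k
    fin_cases k
    · simpa using h0
    · simpa [h0] using hs
  have hfin : (⋃ i, {t : ℂ | br ![1, t] (a i) = 0}).Finite :=
    Set.finite_iUnion fun i => (hinj i).finite
  obtain ⟨t, ht⟩ := hfin.infinite_compl.nonempty
  simp only [Set.mem_compl_iff, Set.mem_iUnion, Set.mem_ofPred_eq, not_exists] at ht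
  exact ⟨![1, t], ht⟩

/-- The base locus of the pencil meets any translate by a sign change of the open set where the
projection from the line `lin a` is invertible. -/
theorem exists_disc_ne_zero_and_flip (G : Finset (Fin 5)) : ∃ v, pencil a ω v = 0 ∧
    disc (proj a ω v) ≠ 0 ∧ disc (proj a ω (flip G v)) ≠ 0 := by
  obtain ⟨f, hf⟩ := h.exists_br_ne_zero
  obtain ⟨S, hS, hGS⟩ := exists_symmDiff_card G
  refine ⟨flip S (lin a f), ?_, h.disc_flip_lin hf hS, ?_⟩
  · rw [pencil_flip, h.pencil_lin]
  · rw [flip_flip]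
    exact h.disc_flip_lin hf hGS

end IsWeighted

/-! ### The inverse of the projection -/

/-- The cubic parametrization of the base locus of the pencil, inverse to the projection `proj a ω`
with section `s`. -/
def param (a : Fin 5 → Fin 2 → ℂ) (ω : Fin 5 → ℂ) (s : (Fin 3 → ℂ) →ₗ[ℂ] (Fin 5 → ℂ))
    (q : Fin 3 → ℂ) : Fin 5 → ℂ :=
  disc q • s q + lin a ((1 / 2 : ℂ) • polarMap q (pencil a ω (s q)))

namespace IsWeighted

variable {a : Fin 5 → Fin 2 → ℂ} {ω : Fin 5 → ℂ} (h : IsWeighted a ω)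
  {s : (Fin 3 → ℂ) →ₗ[ℂ] (Fin 5 → ℂ)} (hs : ∀ q, proj a ω (s q) = q)
include h hs

/-- By `pencil_add_lin`, the correction along the line contributes `disc q • polarMap q (polarMap q
P)` with `P = pencil a ω (s q)`. This is `-disc q ^ 2 • P`, which cancels the first term. -/
theorem pencil_param (q : Fin 3 → ℂ) : pencil a ω (param a ω s q) = 0 := by
  have hp : ∀ (r : ℂ) f, polarMap (r • q) f = r • polarMap q f := fun r f => by
    ext i; fin_cases i <;> simp [polarMap] <;> ring
  rw [param, h.pencil_add_lin, pencil_smul, map_smul, hs, hp, polarMap_smul, polarMap_polarMap,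
    smul_smul, smul_smul, smul_smul, ← add_smul]
  convert zero_smul ℂ _
  ring

theorem param_proj {v : Fin 5 → ℂ} (hv : pencil a ω v = 0) :
    param a ω s (proj a ω v) = disc (proj a ω v) • v := by
  set q := proj a ω v with hq
  obtain ⟨f, hf⟩ := h.exists_lin_of_proj_eq_zero (x := v - s q) (by rw [map_sub, hs, ← hq, sub_self])
  have hv' : v = s q + lin a f := by rw [← hf]; abel
  have h1 : pencil a ω (s q) = (-2 : ℂ) • polarMap q f := by
    rw [hv', h.pencil_add_lin, hs] at hv
    rw [eq_neg_of_add_eq_zero_left hv, neg_smul]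
  conv_rhs => rw [hv', smul_add]
  rw [param, h1, polarMap_smul, polarMap_polarMap, smul_smul, smul_smul, map_smul]
  congr 2
  ring

/-- Here `polarMap q` is nilpotent: its image lies in the span of `a i`, which it kills. A lift of
`q` is a multiple of the `i`-th coordinate vector plus a point of the line, so its pencil value also
lies in that span. -/
theorem param_symMul_self (i : Fin 5) (r : ℂ) : param a ω s (r • symMul (a i) (a i)) = 0 := by
  set q := r • symMul (a i) (a i) with hq
  have hd : disc q = 0 := by rw [hq, disc_smul, disc_symMul_self, mul_zero]
  have hp : ∀ f, polarMap q f = (r * br f (a i)) • a i := fun f => by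
    rw [mul_smul, ← polarMap_symMul_self, hq]
    ext k; fin_cases k <;> simp [polarMap] <;> ring
  obtain ⟨f, hf⟩ := h.exists_lin_of_proj_eq_zero (x := s q - Pi.single i (r / ω i)) (by
    rw [map_sub, hs, proj_single, hq, mul_div_cancel₀ _ (h.ne_zero i), sub_self])
  have hsq : s q = Pi.single i (r / ω i) + lin a f := by rw [← hf]; abel
  have h1 : pencil a ω (Pi.single i (r / ω i)) = (ω i * (r / ω i) ^ 2) • a i := by
    rw [pencil, Finset.sum_eq_single i (fun j _ hji => by simp [hji]) (by simp)]
    simp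
  rw [param, hd, zero_smul, zero_add, hsq, h.pencil_add_lin, h1, proj_single,
    mul_div_cancel₀ _ (h.ne_zero i), ← hq, hp f, smul_smul, ← add_smul, hp]
  have : ∀ t : ℂ, br (t • a i) (a i) = 0 := fun t => by simp [br]; ring
  rw [this]
  simp

theorem exists_param_pairing_ne_zero {L : (Fin 5 → ℂ) →ₗ[ℂ] ℂ} (hL : L ≠ 0) :
    ∃ q, L (param a ω s q) ≠ 0 := by
  by_contra! hall
  obtain ⟨f, hf⟩ := h.exists_br_ne_zero
  have hL' : ∀ S : Finset (Fin 5), (S.card = 2 ∨ S.card = 3) → L (flip S (lin a f)) = 0 := by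
    intro S hS
    have := hall (proj a ω (flip S (lin a f)))
    rw [h.param_proj hs (by rw [pencil_flip, h.pencil_lin]), map_smul] at this
    simpa [h.disc_flip_lin hf hS] using this
  apply hL
  refine (Pi.basisFun ℂ (Fin 5)).ext fun i => ?_
  obtain ⟨S, hS, hi⟩ : ∃ S : Finset (Fin 5), S.card = 2 ∧ i ∉ S := by
    clear hL' hall hL hf
    revert i
    decide
  -- The points for `S` and `insert i S` differ by a nonzero multiple of the `i`-th coordinate
  -- vector, so `L` kills that vector.
  have h1 := hL' S (.inl hS)
  have h2 := hL' (insert i S) (.inr (by rw [Finset.card_insert_of_notMem hi, hS]))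
  rw [flip_eq_sub] at h1 h2
  rw [Finset.sum_insert hi, smul_add, add_comm, ← sub_sub, map_sub, h1, zero_sub, neg_eq_zero, map_smul,
    show (Pi.single i (lin a f i) : Fin 5 → ℂ) = lin a f i • Pi.single i 1 by
      rw [← Pi.single_smul, smul_eq_mul, mul_one], map_smul] at h2
  simpa [lin_apply, hf i] using h2

end IsWeighted

/-! ### Forms as functions -/

theorem _root_.MvPolynomial.IsHomogeneous.eval_smul_eq {m d : ℕ} {F : MvPolynomial (Fin m) ℂ}
    (hF : F.IsHomogeneous d) (r : ℂ) (x : Fin m → ℂ) :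
    MvPolynomial.eval (r • x) F = r ^ d * MvPolynomial.eval x F := by
  rw [MvPolynomial.eval_eq', MvPolynomial.eval_eq', Finset.mul_sum]
  refine Finset.sum_congr rfl fun e he => ?_
  have hd : ∑ i, e i = d := by
    rw [← Finsupp.degree_eq_sum]
    exact (hF.degree_eq_sum_deg_support he).symm
  simp only [Pi.smul_apply, smul_eq_mul, mul_pow, Finset.prod_mul_distrib, Finset.prod_pow_eq_pow_sum,
    hd]
  ring

/-- A function on `ℂᵐ` which is given by a form of degree `d`. -/
def IsForm {m : ℕ} (d : ℕ) (f : (Fin m → ℂ) → ℂ) : Prop :=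
  ∃ F : MvPolynomial (Fin m) ℂ, F.IsHomogeneous d ∧ ∀ x, MvPolynomial.eval x F = f x

namespace IsForm

variable {m d e : ℕ} {f g : (Fin m → ℂ) → ℂ}

theorem add (hf : IsForm d f) (hg : IsForm d g) : IsForm d fun x => f x + g x := by
  obtain ⟨F, hF, hF'⟩ := hf
  obtain ⟨G, hG, hG'⟩ := hg
  exact ⟨F + G, hF.add hG, fun x => by simp [hF', hG']⟩

theorem sub (hf : IsForm d f) (hg : IsForm d g) : IsForm d fun x => f x - g x := by
  obtain ⟨F, hF, hF'⟩ := hf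
  obtain ⟨G, hG, hG'⟩ := hg
  exact ⟨F - G, hF.sub hG, fun x => by simp [hF', hG']⟩

theorem mul (hf : IsForm d f) (hg : IsForm e g) : IsForm (d + e) fun x => f x * g x := by
  obtain ⟨F, hF, hF'⟩ := hf
  obtain ⟨G, hG, hG'⟩ := hg
  exact ⟨F * G, hF.mul hG, fun x => by simp [hF', hG']⟩

theorem const_mul (hf : IsForm d f) (r : ℂ) : IsForm d fun x => r * f x := by
  obtain ⟨F, hF, hF'⟩ := hf
  exact ⟨MvPolynomial.C r * F, hF.C_mul r, fun x => by simp [hF']⟩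

theorem sum {ι : Type*} (s : Finset ι) {f : ι → (Fin m → ℂ) → ℂ} (hf : ∀ i, IsForm d (f i)) :
    IsForm d fun x => ∑ i ∈ s, f i x := by
  choose F hF hF' using hf
  exact ⟨∑ i ∈ s, F i, .sum _ _ _ fun i _ => hF i, fun x => by simp [hF']⟩

theorem linear (L : (Fin m → ℂ) →ₗ[ℂ] ℂ) : IsForm 1 L := by
  refine ⟨∑ k, MvPolynomial.C (L (Pi.single k 1)) * MvPolynomial.X k,
    .sum _ _ _ fun k _ => MvPolynomial.isHomogeneous_C_mul_X _ _,
    fun x => ?_⟩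
  conv_rhs => rw [pi_eq_sum_univ' x]
  simp [mul_comm]

theorem comp {n : ℕ} {f : Fin n → (Fin m → ℂ) → ℂ} (hf : ∀ i, IsForm d (f i))
    {F : MvPolynomial (Fin n) ℂ} (hF : F.IsHomogeneous e) :
    IsForm (d * e) fun x => MvPolynomial.eval (fun i => f i x) F := by
  choose P hP hP' using hf
  refine ⟨MvPolynomial.aeval P F, hF.aeval P hP, fun x => ?_⟩
  simp only [← hP']
  simp only [← MvPolynomial.aeval_eq_eval, ← AlgHom.comp_apply, MvPolynomial.comp_aeval]

theorem linear_comp {n : ℕ} {f : (Fin m → ℂ) → Fin n → ℂ} (hf : ∀ i, IsForm d fun x => f x i)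
    (L : (Fin n → ℂ) →ₗ[ℂ] ℂ) : IsForm d fun x => L (f x) := by
  have : (fun x => L (f x)) = fun x => ∑ i, L (Pi.single i 1) * f x i := by
    ext x
    conv_lhs => rw [pi_eq_sum_univ' (f x)]
    simp [mul_comm]
  rw [this]
  exact sum _ fun i => (hf i).const_mul _

theorem eq_zero_or_eq_zero (hf : IsForm d f) (hg : IsForm e g) (h : ∀ x, f x * g x = 0) :
    (∀ x, f x = 0) ∨ ∀ x, g x = 0 := by
  obtain ⟨F, hF, hF'⟩ := hf
  obtain ⟨G, hG, hG'⟩ := hg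
  have : F * G = 0 := MvPolynomial.funext fun x => by simp [hF', hG', h]
  rcases mul_eq_zero.mp this with rfl | rfl
  · exact .inl fun x => by simp [← hF']
  · exact .inr fun x => by simp [← hG']

theorem disc {f : (Fin m → ℂ) → Fin 3 → ℂ} (hf : ∀ i, IsForm d fun x => f x i) :
    IsForm (d + d) fun x => disc (f x) := by
  have : (fun x => PencilOfQuadrics.disc (f x)) =
      fun x => f x 0 * f x 2 - (1 / 4) * (f x 1 * f x 1) := by
    ext x; simp [PencilOfQuadrics.disc]; ring
  rw [this]
  exact ((hf 0).mul (hf 2)).sub (((hf 1).mul (hf 1)).const_mul _)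

theorem pencil (a : Fin 5 → Fin 2 → ℂ) (ω : Fin 5 → ℂ) {f : (Fin m → ℂ) → Fin 5 → ℂ}
    (hf : ∀ i, IsForm d fun x => f x i) (k : Fin 2) :
    IsForm (d + d) fun x => pencil a ω (f x) k := by
  have : (fun x => PencilOfQuadrics.pencil a ω (f x) k) =
      fun x => ∑ i, (ω i * a i k) * (f x i * f x i) := by
    ext x
    simp only [PencilOfQuadrics.pencil, Finset.sum_apply, Pi.smul_apply, smul_eq_mul]
    exact Finset.sum_congr rfl fun i _ => by ring
  rw [this]
  exact sum _ fun i => ((hf i).mul (hf i)).const_mul _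

theorem coord (i : Fin m) : IsForm 1 fun x : Fin m → ℂ => x i := linear (LinearMap.proj i)

theorem param (a : Fin 5 → Fin 2 → ℂ) (ω : Fin 5 → ℂ) (s : (Fin 3 → ℂ) →ₗ[ℂ] (Fin 5 → ℂ))
    (i : Fin 5) : IsForm 3 fun q => param a ω s q i := by
  have hs : ∀ i, IsForm 1 fun q => s q i := fun i => linear (LinearMap.proj i ∘ₗ s)
  have hQ := pencil a ω hs
  have : (fun q => PencilOfQuadrics.param a ω s q i) = fun q =>
      PencilOfQuadrics.disc q * s q i +
        (((a i 1 / 4) * (q 1 * PencilOfQuadrics.pencil a ω (s q) 0) -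
          (a i 1 / 2) * (q 0 * PencilOfQuadrics.pencil a ω (s q) 1)) -
        ((a i 0 / 2) * (q 2 * PencilOfQuadrics.pencil a ω (s q) 0) -
          (a i 0 / 4) * (q 1 * PencilOfQuadrics.pencil a ω (s q) 1))) := by
    ext q
    simp [PencilOfQuadrics.param, lin_apply, br, polarMap]
    ring
  rw [this]
  have hq := coord (m := 3)
  exact ((disc hq).mul (hs i)).add
    (((((hq 1).mul (hQ 0)).const_mul _).sub (((hq 0).mul (hQ 1)).const_mul _)).sub
      ((((hq 2).mul (hQ 0)).const_mul _).sub (((hq 1).mul (hQ 1)).const_mul _)))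

end IsForm

/-! ### The del Pezzo surface is the base locus of the pencil -/

theorem diag_rep (x : PSpace 1) : ∃ r : ℂ, r ≠ 0 ∧ (diag x).rep = r • symMul x.rep x.rep := by
  obtain ⟨r, hr⟩ := Projectivization.exists_smul_eq_mk_rep ℂ (symMul x.rep x.rep)
    (symMul_ne_zero x.rep_nonzero x.rep_nonzero)
  exact ⟨r, r.ne_zero, by rw [diag, pairPoint, ← hr, Units.smul_def]⟩

theorem exists_linearEquiv_param {p : Fin 5 → PSpace 1} {ω : Fin 5 → ℂ}
    (h : IsWeighted (fun i => (p i).rep) ω) {s : (Fin 3 → ℂ) →ₗ[ℂ] (Fin 5 → ℂ)}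
    (hs : ∀ q, proj (fun i => (p i).rep) ω (s q) = q)
    (c : Module.Basis (Fin 5) ℂ (cubicsThrough p)) :
    ∃ T : (Fin 5 → ℂ) ≃ₗ[ℂ] (Fin 5 → ℂ),
      ∀ q, T (cubicMap c q) = param (fun i => (p i).rep) ω s q := by
  choose P hP hP' using IsForm.param (fun i => (p i).rep) ω s
  have hmem : ∀ i, P i ∈ cubicsThrough p := fun i => by
    refine ⟨hP i, fun j => ?_⟩
    obtain ⟨r, -, hr⟩ := diag_rep (p j)
    rw [hP', hr]
    exact congrFun (h.param_symMul_self hs j r) i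
  let T₀ : (Fin 5 → ℂ) →ₗ[ℂ] (Fin 5 → ℂ) :=
    (Matrix.of fun i k => c.repr ⟨P i, hmem i⟩ k).mulVecLin
  have hT : ∀ q, T₀ (cubicMap c q) = param (fun i => (p i).rep) ω s q := fun q => by
    ext i
    refine Eq.trans ?_ (hP' i q)
    have := congrArg (fun F : cubicsThrough p => MvPolynomial.eval q (F : MvPolynomial (Fin 3) ℂ))
      (c.sum_repr ⟨P i, hmem i⟩)
    simp only at this
    rw [← this]
    simp [T₀, Matrix.mulVec, dotProduct, cubicMap, MvPolynomial.smul_eval, -Module.Basis.sum_repr]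
  have hsurj : Function.Surjective T₀ := by
    rw [← LinearMap.range_eq_top]
    by_contra hne
    -- A functional killing the range of `T₀` would be a linear equation satisfied by all values of
    -- `param`.
    obtain ⟨L, hL, hle⟩ := Submodule.exists_le_ker_of_lt_top _ (lt_top_iff_ne_top.mpr hne)
    obtain ⟨q, hq⟩ := h.exists_param_pairing_ne_zero hs hL
    exact hq (by rw [← hT]; exact hle ⟨_, rfl⟩)
  exact ⟨LinearEquiv.ofBijective T₀ ⟨LinearMap.injective_iff_surjective.mpr hsurj, hsurj⟩, hT⟩

theorem mem_delPezzo_iff {p : Fin 5 → PSpace 1} {ω : Fin 5 → ℂ}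
    (h : IsWeighted (fun i => (p i).rep) ω) {s : (Fin 3 → ℂ) →ₗ[ℂ] (Fin 5 → ℂ)}
    (hs : ∀ q, proj (fun i => (p i).rep) ω (s q) = q)
    {c : Module.Basis (Fin 5) ℂ (cubicsThrough p)} {T : (Fin 5 → ℂ) ≃ₗ[ℂ] (Fin 5 → ℂ)}
    (hT : ∀ q, T (cubicMap c q) = param (fun i => (p i).rep) ω s q) (y : PSpace 4) :
    y ∈ delPezzo c ↔ pencil (fun i => (p i).rep) ω (T y.rep) = 0 := by
  set a := fun i => (p i).rep
  constructor
  · intro hy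
    ext k
    obtain ⟨F, hF, hF'⟩ := IsForm.pencil a ω
      (fun i => IsForm.linear (LinearMap.proj i ∘ₗ T.toLinearMap)) k
    rw [Pi.zero_apply]
    refine (hF' y.rep).symm.trans (hy _ F hF ?_)
    rintro z ⟨x, hx, rfl⟩
    obtain ⟨r, hr⟩ := Projectivization.exists_smul_eq_mk_rep ℂ _ hx
    rw [← hr, Units.smul_def, hF.eval_smul_eq, hF']
    have := h.pencil_param hs x
    rw [← hT] at this
    exact mul_eq_zero_of_right _ (congrFun this k)
  · intro hy d F hF hz
    have himg : ∀ q, param a ω s q ≠ 0 → MvPolynomial.eval (T.symm (param a ω s q)) F = 0 := by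
      intro q hq
      rw [← hT] at hq ⊢
      have hc : cubicMap c q ≠ 0 := fun h0 => hq (by rw [h0, map_zero])
      obtain ⟨r, hr⟩ := Projectivization.exists_smul_eq_mk_rep ℂ _ hc
      have := hz _ ⟨q, hc, rfl⟩
      rw [← hr, Units.smul_def, hF.eval_smul_eq] at this
      simpa using this
    have hopen : ∀ v, pencil a ω v = 0 → disc (proj a ω v) ≠ 0 →
        MvPolynomial.eval (T.symm v) F = 0 := by
      intro v hv hd
      have hv0 : v ≠ 0 := by rintro rfl; exact hd (by simp [disc])
      have := himg (proj a ω v)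
      rw [h.param_proj hs hv, map_smul, hF.eval_smul_eq] at this
      simpa [hd, hv0] using this
    have hv0 : T y.rep ≠ 0 := by simpa using y.rep_nonzero
    obtain ⟨G, hG⟩ := h.exists_flip_disc_ne_zero hy hv0
    have hA := IsForm.comp (fun i => IsForm.linear_comp (IsForm.param a ω s)
      (LinearMap.proj i ∘ₗ T.symm.toLinearMap ∘ₗ flip G)) hF
    have hB := IsForm.disc fun i => IsForm.linear_comp (IsForm.param a ω s)
      (LinearMap.proj i ∘ₗ proj a ω ∘ₗ flip G)
    -- Irreducibility of the plane: the pullback of `F` by the sign change, times a discriminant,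
    -- vanishes identically, so one factor does. The discriminant is nonzero at some point by
    -- `exists_disc_ne_zero_and_flip`.
    have hAB := hA.eq_zero_or_eq_zero hB fun q => by
      by_cases hd : disc (proj a ω (flip G (param a ω s q))) = 0
      · exact mul_eq_zero_of_right _ hd
      · exact mul_eq_zero_of_left
          (hopen _ (by rw [pencil_flip, h.pencil_param hs]) hd) _
    rcases hAB with h0 | h0
    · have := h0 (proj a ω (flip G (T y.rep)))
      rw [h.param_proj hs (by rw [pencil_flip, hy])] at this
      have e : (fun i => (LinearMap.proj i ∘ₗ T.symm.toLinearMap ∘ₗ flip G)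
          (disc (proj a ω (flip G (T y.rep))) • flip G (T y.rep))) =
          disc (proj a ω (flip G (T y.rep))) • y.rep := by
        ext i
        simp [flip_flip_self]
      rw [e, hF.eval_smul_eq] at this
      simpa [hG] using this
    · obtain ⟨v, hv, hd, hd'⟩ := h.exists_disc_ne_zero_and_flip G
      have := h0 (proj a ω v)
      rw [h.param_proj hs hv] at this
      change disc (proj a ω (flip G (disc (proj a ω v) • v))) = 0 at this
      rw [map_smul, map_smul, disc_smul] at this
      simp [hd, hd'] at this

theorem br_rep_ne_zero {x y : PSpace 1} (hxy : x ≠ y) : br x.rep y.rep ≠ 0 := by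
  intro h0
  obtain ⟨r, hr⟩ := exists_smul_of_br_eq_zero y.rep_nonzero h0
  apply hxy
  rw [← x.mk_rep, ← y.mk_rep, Projectivization.mk_eq_mk_iff']
  exact ⟨r, hr.symm⟩

/-! ### The dimension of the linear system of cubics -/

theorem finrank_homogeneousSubmodule (m d : ℕ) :
    Module.finrank ℂ (MvPolynomial.homogeneousSubmodule (Fin m) ℂ d) = (m + d - 1).choose d := by
  rw [MvPolynomial.homogeneousSubmodule_eq_finsupp_supported,
    (AddMonoidAlgebra.supportedEquivFinsupp (R := ℂ) (S := ℂ)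
      {e : Fin m →₀ ℕ | e.degree = d}).finrank_eq]
  have : {e : Fin m →₀ ℕ | e.degree = d} = ((Finset.univ : Finset (Fin m)).finsuppAntidiag d) := by
    ext e
    simp [Finsupp.degree_eq_sum]
  rw [this]
  have := Finset.card_finsuppAntidiag_nat_eq_choose (s := (Finset.univ : Finset (Fin m))) d
  rw [Finset.card_univ, Fintype.card_fin] at this
  rw [← this, Module.finrank_finsupp_self]
  simp

/-- The polar form of a point with respect to the conic. -/
def conicPolar (z : Fin 3 → ℂ) : (Fin 3 → ℂ) →ₗ[ℂ] ℂ where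
  toFun q := z 0 * q 2 - z 1 * q 1 / 2 + z 2 * q 0
  map_add' x y := by simp; ring
  map_smul' r x := by simp; ring

theorem conicPolar_symMul_self (u v w : Fin 2 → ℂ) :
    conicPolar (symMul v w) (symMul u u) = br v u * br w u := by
  simp [conicPolar, symMul, br]; ring

/-- The five points impose independent conditions on the ten-dimensional space of cubics: for each
point, some product of three lines misses it and passes through the other four. -/
theorem finrank_cubicsThrough {p : Fin 5 → PSpace 1} (hp : Function.Injective p) :
    Module.finrank ℂ (cubicsThrough p) = 5 := by
  let V := MvPolynomial.homogeneousSubmodule (Fin 3) ℂ 3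
  let ev : V →ₗ[ℂ] (Fin 5 → ℂ) :=
    LinearMap.pi fun i => (MvPolynomial.aeval (diag (p i)).rep).toLinearMap ∘ₗ V.subtype
  have hev : ∀ F i, ev F i = MvPolynomial.eval (diag (p i)).rep F.1 := fun F i => by
    simp [ev, MvPolynomial.aeval_eq_eval]
  have hker : cubicsThrough p = (LinearMap.ker ev).map V.subtype := by
    ext F
    constructor
    · rintro ⟨hF, hF'⟩
      exact ⟨⟨F, hF⟩, LinearMap.mem_ker.mpr (funext fun i => (hev _ _).trans (hF' i)), rfl⟩
    · rintro ⟨F, hF, rfl⟩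
      exact ⟨F.2, fun i => (hev F i).symm.trans (congrFun (LinearMap.mem_ker.mp hF) i)⟩
  have hrange : LinearMap.range ev = ⊤ := by
    by_contra hne
    obtain ⟨L, hL, hle⟩ := Submodule.exists_le_ker_of_lt_top _ (lt_top_iff_ne_top.mpr hne)
    refine hL ((Pi.basisFun ℂ (Fin 5)).ext fun i => ?_)
    obtain ⟨j, k, l, m, hj, hk, hl, hm, hall⟩ : ∃ j k l m : Fin 5, j ≠ i ∧ k ≠ i ∧ l ≠ i ∧ m ≠ i ∧
        ∀ n, n = i ∨ n = j ∨ n = k ∨ n = l ∨ n = m := by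
      clear hle hL hne hker hev ev V hp
      revert i
      decide
    -- The chords `jk` and `lm` already contain the four points; the tangent at `l` only raises the
    -- degree to three.
    have hform := ((IsForm.linear (conicPolar (symMul (p j).rep (p k).rep))).mul
      (IsForm.linear (conicPolar (symMul (p l).rep (p m).rep)))).mul
      (IsForm.linear (conicPolar (symMul (p l).rep (p l).rep)))
    obtain ⟨F, hF, hF'⟩ := hform
    have hval : ∀ n, ∃ r : ℂ, r ≠ 0 ∧ ev ⟨F, hF⟩ n = r *
        (br (p j).rep (p n).rep * br (p k).rep (p n).rep * br (p l).rep (p n).rep ^ 3 *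
          br (p m).rep (p n).rep) := fun n => by
      obtain ⟨r, hr, hr'⟩ := diag_rep (p n)
      refine ⟨r ^ 3, pow_ne_zero _ hr, ?_⟩
      rw [hev, hF', hr']
      simp only [map_smul, conicPolar_symMul_self, smul_eq_mul]
      ring
    have hsingle : ev ⟨F, hF⟩ = ev ⟨F, hF⟩ i • Pi.single i 1 := by
      ext n
      rcases hall n with rfl | rfl | rfl | rfl | rfl
      · simp
      all_goals
        obtain ⟨r, -, hr⟩ := hval n
        rw [hr, br_self]
        simp [*]
    have hi : ev ⟨F, hF⟩ i ≠ 0 := by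
      obtain ⟨r, hr0, hr⟩ := hval i
      rw [hr]
      have hb : ∀ n, n ≠ i → br (p n).rep (p i).rep ≠ 0 := fun n hn => br_rep_ne_zero (hp.ne hn)
      simp [hr0, hb _ hj, hb _ hk, hb _ hl, hb _ hm]
    have : L (ev ⟨F, hF⟩) = 0 := hle ⟨_, rfl⟩
    rw [hsingle, map_smul, smul_eq_mul, mul_eq_zero, or_iff_right hi] at this
    simpa using this
  have hV : Module.finrank ℂ V = 10 := by
    rw [finrank_homogeneousSubmodule]; rfl
  have := Module.finite_of_finrank_pos (by rw [hV]; norm_num : 0 < Module.finrank ℂ V)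
  have hdim := ev.finrank_range_add_finrank_ker
  rw [hrange, hV, finrank_top, Module.finrank_fin_fun] at hdim
  rw [hker, Submodule.finrank_map_subtype_eq]
  omega

/-! ### The quadrics through the base locus -/

namespace IsWeighted

variable {a : Fin 5 → Fin 2 → ℂ} {ω : Fin 5 → ℂ} (h : IsWeighted a ω)
include h

/-- The quadratic forms vanishing on the base locus of the pencil are its members. -/
theorem exists_eq_br_pencil {q : QuadraticForm ℂ (Fin 5 → ℂ)}
    (hq : ∀ v, pencil a ω v = 0 → q v = 0) : ∃ g, ∀ v, q v = br g (pencil a ω v) := by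
  obtain ⟨f, hf⟩ := h.exists_br_ne_zero
  -- The base locus contains the sign-change orbit of a point with no zero coordinate, which kills
  -- all off-diagonal coefficients.
  have hpolar : ∀ i j, i ≠ j → QuadraticMap.polar q (Pi.single i 1) (Pi.single j 1) = 0 := by
    intro i j hij
    have hflip : ∀ G, q (flip G (lin a f)) = 0 := fun G => hq _ (by rw [pencil_flip, h.pencil_lin])
    have := map_flip_alternating_sum q hij (lin a f)
    simpa [hflip, lin_apply, hf] using this
  have hdiag : ∀ v, q v = ∑ i, q (Pi.single i 1) * v i ^ 2 := by
    intro v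
    have := QuadraticMap.basisRepr_eq_of_iIsOrtho q (Pi.basisFun ℂ (Fin 5)) (by
      intro i j hij
      have := hpolar i j hij
      rw [QuadraticMap.polar] at this
      simp [QuadraticMap.associated_apply, Function.onFun, this])
    have := congrArg (fun Q : QuadraticForm ℂ (Fin 5 → ℂ) => Q v) this
    simp only [QuadraticMap.basisRepr_apply, QuadraticMap.weightedSumSquares_apply,
      Pi.basisFun_apply, smul_eq_mul] at this
    rw [← pi_eq_sum_univ'] at this
    rw [this]
    exact Finset.sum_congr rfl fun i _ => by ring
  -- Vanishing on the line makes the diagonal coefficients orthogonal to squares of linear forms.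
  -- Three such squares span the quadratic forms, so duality yields `g`.
  obtain ⟨g, hg⟩ := h.exists_lin_of_sum_eq_zero (x := fun i => q (Pi.single i 1) / ω i) fun z => by
    have hl : ∀ f, ∑ i, q (Pi.single i 1) * (br f (a i)) ^ 2 = 0 := fun f =>
      (hdiag (lin a f)).symm.trans (hq _ (h.pencil_lin f))
    have h0 := hl ![1, 0]
    have h1 := hl ![0, 1]
    have h2 := hl ![1, 1]
    have e : ∀ i, ω i * (tang (a i) z * (q (Pi.single i 1) / ω i)) =
        tang (a i) z * q (Pi.single i 1) := fun i => by
      have := h.ne_zero i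
      field_simp
    simp only [e]
    simp only [Fin.sum_univ_five, br, Matrix.cons_val_zero, Matrix.cons_val_one] at h0 h1 h2
    simp only [Fin.sum_univ_five, tang_apply]
    linear_combination z 0 * h0 + z 2 * h1 + z 1 / 2 * (h2 - h0 - h1)
  refine ⟨g, fun v => ?_⟩
  rw [hdiag, br_pencil]
  refine Finset.sum_congr rfl fun i _ => ?_
  have := congrFun hg i
  rw [lin_apply, div_eq_iff (h.ne_zero i)] at this
  rw [this, mul_comm (ω i)]

/-- The points of the line parametrize the quadrics through the base locus of the pencil. -/
theorem exists_linearEquiv_quadricsThrough {S : Set (PSpace 4)}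
    {T : (Fin 5 → ℂ) ≃ₗ[ℂ] (Fin 5 → ℂ)} (hS : ∀ y, y ∈ S ↔ pencil a ω (T y.rep) = 0) :
    ∃ Φ : (Fin 2 → ℂ) ≃ₗ[ℂ] quadricsThrough S,
      ∀ g v, (Φ g : QuadraticForm ℂ (Fin 5 → ℂ)) v = br g (pencil a ω (T v)) := by
  let D : (Fin 2 → ℂ) → QuadraticForm ℂ (Fin 5 → ℂ) := fun g =>
    (QuadraticMap.weightedSumSquares ℂ fun i => ω i * br g (a i)).comp T.toLinearMap
  have hD : ∀ g v, D g v = br g (pencil a ω (T v)) := fun g v => by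
    rw [br_pencil]
    simp [D, QuadraticMap.weightedSumSquares_apply, sq]
  let φ : (Fin 2 → ℂ) →ₗ[ℂ] quadricsThrough S :=
    { toFun := fun g => ⟨D g, fun y hy => by rw [hD, (hS y).mp hy]; simp [br]⟩
      map_add' := fun g g' => by
        ext v
        simp only [Submodule.coe_add, add_apply, hD]
        simp [br]; ring
      map_smul' := fun r g => by
        ext v
        simp only [Submodule.coe_smul, smul_apply, hD]
        simp [br]; ring }
  have hφ : ∀ g v, (φ g : QuadraticForm ℂ (Fin 5 → ℂ)) v = br g (pencil a ω (T v)) := hD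
  have hinj : Function.Injective φ := by
    rw [injective_iff_map_eq_zero]
    intro g hg
    refine (injective_iff_map_eq_zero _).mp h.lin_injective g (funext fun i => ?_)
    have := hφ g (T.symm (Pi.single i 1))
    rw [hg, br_pencil, T.apply_symm_apply,
      Finset.sum_eq_single i (fun j _ hji => by simp [hji]) (by simp)] at this
    simpa [h.ne_zero i, lin_apply] using this
  have hsurj : Function.Surjective φ := by
    rintro ⟨q, hq⟩
    obtain ⟨g, hg⟩ := h.exists_eq_br_pencil (q := q.comp T.symm.toLinearMap) fun v hv => by
      by_cases hv0 : v = 0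
      · simp [hv0]
      · have hne : T.symm v ≠ 0 := by simpa using hv0
        obtain ⟨r, hr⟩ := Projectivization.exists_smul_eq_mk_rep ℂ _ hne
        have := hq (Projectivization.mk ℂ _ hne) ((hS _).mpr (by
          rw [← hr, Units.smul_def, map_smul, T.apply_symm_apply, pencil_smul, hv, smul_zero]))
        rw [← hr, Units.smul_def, QuadraticMap.map_smul] at this
        simpa using this
    refine ⟨g, Subtype.ext (QuadraticMap.ext fun v => ?_)⟩
    rw [hφ, ← hg]
    simp
  exact ⟨LinearEquiv.ofBijective φ ⟨hinj, hsurj⟩, hφ⟩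

end IsWeighted

/-! ### Singular members of the pencil and their vertices -/

section Model

variable {a : Fin 5 → Fin 2 → ℂ} {ω : Fin 5 → ℂ} {S : Set (PSpace 4)}
  {T : (Fin 5 → ℂ) ≃ₗ[ℂ] (Fin 5 → ℂ)} {Φ : (Fin 2 → ℂ) ≃ₗ[ℂ] quadricsThrough S}

theorem eq_base_locus (hS : ∀ y, y ∈ S ↔ pencil a ω (T y.rep) = 0)
    (hΦ : ∀ g v, (Φ g : QuadraticForm ℂ (Fin 5 → ℂ)) v = br g (pencil a ω (T v))) :
    S = {y | ∀ q ∈ quadricsThrough S, q y.rep = 0} := by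
  ext y
  refine ⟨fun hy q hq => hq y hy, fun hy => (hS y).mpr (eq_zero_of_br_eq_zero fun g => ?_)⟩
  rw [← hΦ]
  exact hy _ (Φ g).2

/-- In the coordinates `T` the member is diagonal with coefficients `ωᵢ g(aᵢ)`, so a vertex is
supported where these vanish. -/
theorem isVertex_iff (h : IsWeighted a ω)
    (hΦ : ∀ g v, (Φ g : QuadraticForm ℂ (Fin 5 → ℂ)) v = br g (pencil a ω (T v)))
    (l : ParameterSpace S) (v : PSpace 4) :
    IsVertex l v ↔ ∀ i, br (Φ.symm l.rep) (a i) = 0 ∨ T v.rep i = 0 := by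
  set g := Φ.symm l.rep with hg
  have hpolar : ∀ w, QuadraticMap.polar (member l) v.rep w =
      ∑ i, 2 * (ω i * br g (a i) * T v.rep i * T w i) := fun w => by
    have hm : ∀ v, member l v = br g (pencil a ω (T v)) := fun v => by
      rw [← hΦ, hg, Φ.apply_symm_apply]; rfl
    simp only [QuadraticMap.polar, hm, br_pencil, map_add, Pi.add_apply, ← Finset.sum_sub_distrib]
    exact Finset.sum_congr rfl fun i _ => by ring
  constructor
  · intro hv i
    have := hv (T.symm (Pi.single i 1))
    rw [hpolar, T.apply_symm_apply,
      Finset.sum_eq_single i (fun j _ hji => by simp [hji]) (by simp)] at this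
    simpa [h.ne_zero i] using this
  · intro hv w
    rw [hpolar]
    refine Finset.sum_eq_zero fun i _ => ?_
    rcases hv i with hi | hi <;> simp [hi]

/-- The parameter of the `i`-th singular quadric. -/
def singularParameter (h : IsWeighted a ω) (Φ : (Fin 2 → ℂ) ≃ₗ[ℂ] quadricsThrough S) (i : Fin 5) :
    ParameterSpace S :=
  Projectivization.mk ℂ (Φ (a i)) (by simpa using h.point_ne_zero i)

theorem eq_singularParameter_iff (h : IsWeighted a ω) (l : ParameterSpace S) (i : Fin 5) :
    l = singularParameter h Φ i ↔ br (Φ.symm l.rep) (a i) = 0 := by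
  constructor
  · rintro rfl
    obtain ⟨r, hr⟩ := Projectivization.exists_smul_eq_mk_rep ℂ (Φ (a i))
      (by simpa using h.point_ne_zero i)
    rw [singularParameter, ← hr, Units.smul_def, map_smul, Φ.symm_apply_apply]
    simp [br]; ring
  · intro h0
    obtain ⟨r, hr⟩ := exists_smul_of_br_eq_zero (h.point_ne_zero i) h0
    rw [singularParameter, ← l.mk_rep, Projectivization.mk_eq_mk_iff']
    exact ⟨r, by rw [← map_smul, ← hr, Φ.apply_symm_apply]⟩

theorem singularParameter_injective (h : IsWeighted a ω) :
    Function.Injective (singularParameter h Φ) := by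
  intro i j hij
  by_contra hne
  rw [singularParameter, singularParameter, Projectivization.mk_eq_mk_iff'] at hij
  obtain ⟨r, hr⟩ := hij
  rw [← map_smul] at hr
  have : br (a i) (a j) = 0 := by
    rw [← Φ.injective hr]; simp [br]; ring
  exact h.br_ne i j hne this

theorem br_ne_zero_of_eq_singularParameter (h : IsWeighted a ω) {l : ParameterSpace S}
    {i j : Fin 5} (hl : l = singularParameter h Φ i) (hij : j ≠ i) :
    br (Φ.symm l.rep) (a j) ≠ 0 := fun h0 =>
  hij (singularParameter_injective h
    (((eq_singularParameter_iff h l j).mpr h0).symm.trans hl))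

theorem isVertex_singularParameter (h : IsWeighted a ω)
    (hΦ : ∀ g v, (Φ g : QuadraticForm ℂ (Fin 5 → ℂ)) v = br g (pencil a ω (T v)))
    (i : Fin 5) (v : PSpace 4) :
    IsVertex (singularParameter h Φ i) v ↔ ∀ j, j ≠ i → T v.rep j = 0 := by
  rw [isVertex_iff h hΦ]
  refine forall_congr' fun j => ?_
  by_cases hj : j = i
  · simp [hj, (eq_singularParameter_iff h (singularParameter h Φ i) i).mp rfl]
  · simp [hj, br_ne_zero_of_eq_singularParameter h rfl hj]

/-- A member of the pencil with a vertex is one of the five singular quadrics. -/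
theorem exists_eq_singularParameter (h : IsWeighted a ω)
    (hΦ : ∀ g v, (Φ g : QuadraticForm ℂ (Fin 5 → ℂ)) v = br g (pencil a ω (T v)))
    {l : ParameterSpace S} {v : PSpace 4} (hv : IsVertex l v) :
    ∃ i, l = singularParameter h Φ i := by
  have hne : T v.rep ≠ 0 := by simpa using v.rep_nonzero
  obtain ⟨i, hi⟩ := Function.ne_iff.mp hne
  exact ⟨i, (eq_singularParameter_iff h l i).mpr
    (((isVertex_iff h hΦ l v).mp hv i).resolve_right hi)⟩

theorem existsUnique_isVertex (h : IsWeighted a ω)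
    (hΦ : ∀ g v, (Φ g : QuadraticForm ℂ (Fin 5 → ℂ)) v = br g (pencil a ω (T v)))
    (i : Fin 5) : ∃! v, IsVertex (singularParameter h Φ i) v := by
  have hne : T.symm (Pi.single i 1) ≠ 0 := by simp
  refine ⟨Projectivization.mk ℂ _ hne, ?_, fun v hv => ?_⟩
  · obtain ⟨r, hr⟩ := Projectivization.exists_smul_eq_mk_rep ℂ _ hne
    refine (isVertex_singularParameter h hΦ i _).mpr fun j hj => ?_
    rw [← hr, Units.smul_def, map_smul, T.apply_symm_apply]
    simp [hj]
  · rw [← v.mk_rep, Projectivization.mk_eq_mk_iff']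
    refine ⟨T v.rep i, ?_⟩
    rw [← map_smul, T.symm_apply_eq]
    ext j
    by_cases hj : j = i
    · subst hj; simp
    · simp [hj, (isVertex_singularParameter h hΦ i v).mp hv j hj]

theorem singularMembers_eq_range (h : IsWeighted a ω)
    (hΦ : ∀ g v, (Φ g : QuadraticForm ℂ (Fin 5 → ℂ)) v = br g (pencil a ω (T v))) :
    singularMembers S = Set.range (singularParameter h Φ) := by
  ext l
  constructor
  · rintro ⟨v, hv⟩
    obtain ⟨i, rfl⟩ := exists_eq_singularParameter h hΦ hv
    exact ⟨i, rfl⟩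
  · rintro ⟨i, rfl⟩
    exact (existsUnique_isVertex h hΦ i).exists

theorem ncard_singularMembers (h : IsWeighted a ω)
    (hΦ : ∀ g v, (Φ g : QuadraticForm ℂ (Fin 5 → ℂ)) v = br g (pencil a ω (T v))) :
    (singularMembers S).ncard = 5 := by
  rw [singularMembers_eq_range h hΦ, ← Set.image_univ,
    Set.ncard_image_of_injective _ (singularParameter_injective h), Set.ncard_univ]
  simp

end Model

/-! ### Matchings through the vertices -/

section Matching

variable {p : Fin 5 → PSpace 1} {ω : Fin 5 → ℂ} {S : Set (PSpace 4)}
  {T : (Fin 5 → ℂ) ≃ₗ[ℂ] (Fin 5 → ℂ)} {Φ : (Fin 2 → ℂ) ≃ₗ[ℂ] quadricsThrough S}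

theorem isVertexMatching_singularParameter (h : IsWeighted (fun i => (p i).rep) ω)
    (hS : ∀ y, y ∈ S ↔ pencil (fun i => (p i).rep) ω (T y.rep) = 0)
    (hΦ : ∀ g v, (Φ g : QuadraticForm ℂ (Fin 5 → ℂ)) v =
      br g (pencil (fun i => (p i).rep) ω (T v))) :
    IsVertexMatching p S (singularParameter h Φ) := by
  let e : Module.Basis (Fin 5) ℂ (Fin 5 → ℂ) := (Pi.basisFun ℂ (Fin 5)).map T.symm
  have he : ∀ v i, e.repr v i = T v i := fun v i => by simp [e]
  -- On the surface the squared coordinates are the values of a quadratic form `z`; a left inverse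
  -- of `quad` recovers `z`, the image point in `S²C`.
  obtain ⟨g, hg⟩ := LinearMap.exists_leftInverse_of_injective (quad fun i => (p i).rep)
    (LinearMap.ker_eq_bot.mpr h.quad_injective)
  have hz : ∀ y : S, ∃ z ≠ 0, (∀ i, T y.1.rep i ^ 2 = tang (p i).rep z) ∧
      g (fun i => e.repr y.1.rep i ^ 2) = z := fun y => by
    obtain ⟨z, hz⟩ := h.exists_quad_of_pencil_eq_zero ((hS y.1).mp y.2)
    refine ⟨z, ?_, hz, ?_⟩
    · rintro rfl
      apply y.1.rep_nonzero
      rw [← T.map_eq_zero_iff]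
      ext i
      simpa using hz i
    · rw [← LinearMap.id_apply (R := ℂ) z, ← hg, LinearMap.comp_apply]
      congr 1
      ext i
      rw [he, hz, quad_apply]
  choose z hz0 hz1 hz2 using hz
  refine ⟨e, fun i => ?_, fun y => Projectivization.mk ℂ (z y) (hz0 y), ⟨g, fun y => ?_⟩, fun i => ?_⟩
  · rw [isVertex_singularParameter h hΦ]
    intro j hj
    obtain ⟨r, hr⟩ := Projectivization.exists_smul_eq_mk_rep ℂ (e i) (e.ne_zero i)
    rw [basisPoint, ← hr, Units.smul_def, map_smul]
    simp [e, hj]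
  · have h2 := hz2 y
    exact ⟨by rw [h2]; exact hz0 y, by simp only [h2]⟩
  · ext y
    rw [Set.mem_preimage, mem_tangentLine_iff, tang_mk_rep_eq_zero_iff, Set.mem_ofPred_eq, he,
      ← hz1]
    simp

theorem exists_smul_of_ker_le {V : Type*} [AddCommGroup V] [Module ℂ V] {L M : V →ₗ[ℂ] ℂ}
    (hLM : ∀ z, M z = 0 → L z = 0) : ∃ k : ℂ, ∀ z, L z = k * M z := by
  by_cases hM : ∀ z, M z = 0
  · exact ⟨0, fun z => by rw [hLM z (hM z), zero_mul]⟩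
  · push Not at hM
    obtain ⟨w, hw⟩ := hM
    refine ⟨L w / M w, fun z => ?_⟩
    have := hLM (z - (M z / M w) • w) (by simp [hw])
    rw [map_sub, map_smul, sub_eq_zero, smul_eq_mul] at this
    rw [this]
    ring

/-- The coordinate system of a matching is that of the model, up to permutation and scaling. -/
theorem exists_perm_of_isVertex (h : IsWeighted (fun i => (p i).rep) ω)
    (hΦ : ∀ g v, (Φ g : QuadraticForm ℂ (Fin 5 → ℂ)) v =
      br g (pencil (fun i => (p i).rep) ω (T v)))
    {l : Fin 5 → ParameterSpace S} {e : Module.Basis (Fin 5) ℂ (Fin 5 → ℂ)}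
    (he : ∀ i, IsVertex (l i) (basisPoint e i)) :
    ∃ (σ : Equiv.Perm (Fin 5)) (t : Fin 5 → ℂ), (∀ i, t i ≠ 0) ∧
      (∀ i, l i = singularParameter h Φ (σ i)) ∧ ∀ v i, e.repr v i = T v (σ i) / t i := by
  choose σ hσ using fun i => exists_eq_singularParameter h hΦ (he i)
  have hTe : ∀ i, T (e i) = T (e i) (σ i) • Pi.single (σ i) 1 := fun i => by
    ext j
    by_cases hj : j = σ i
    · simp [hj]
    · obtain ⟨r, hr⟩ := Projectivization.exists_smul_eq_mk_rep ℂ (e i) (e.ne_zero i)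
      have := he i
      rw [hσ, isVertex_singularParameter h hΦ] at this
      have := this j hj
      rw [basisPoint, ← hr, Units.smul_def, map_smul] at this
      have : T (e i) j = 0 := by simpa using this
      simp [hj, this]
  have ht : ∀ i, T (e i) (σ i) ≠ 0 := fun i h0 => by
    have := hTe i
    rw [h0, zero_smul, T.map_eq_zero_iff] at this
    exact e.ne_zero i this
  -- Two basis vectors on the same coordinate axis would be proportional.
  have hinj : Function.Injective σ := by
    intro i j hij
    by_contra hne
    have h1 : T (T (e j) (σ j) • e i - T (e i) (σ i) • e j) = 0 := by
      rw [map_sub, map_smul, map_smul, hTe i, hTe j, hij, sub_eq_zero]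
      simp [smul_smul, mul_comm]
    rw [T.map_eq_zero_iff] at h1
    have h2 := congrArg (fun v => e.repr v i) h1
    simp [Ne.symm hne] at h2
    exact ht j h2
  refine ⟨Equiv.ofBijective σ (Finite.injective_iff_bijective.mp hinj), fun i => T (e i) (σ i), ht,
    hσ, fun v i => ?_⟩
  rw [eq_div_iff (ht i)]
  conv_rhs => rw [← e.sum_repr v]
  rw [map_sum, Finset.sum_apply, Finset.sum_eq_single i]
  · simp
  · intro j _ hj
    rw [map_smul, hTe j]
    simp [hinj.eq_iff, hj.symm]
  · simp

/-- The linear relations between five tangent lines of the conic transport along a projectivity that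
permutes them. -/
theorem exists_linearEquiv_of_tang {a : Fin 5 → Fin 2 → ℂ} (h : IsWeighted a ω)
    {G : (Fin 3 → ℂ) →ₗ[ℂ] (Fin 3 → ℂ)} (hG : ∀ z, z ≠ 0 → G z ≠ 0) (σ : Equiv.Perm (Fin 5))
    (hGσ : ∀ z i, tang (a i) (G z) = 0 ↔ tang (a (σ i)) z = 0) :
    ∃ A : (Fin 2 → ℂ) ≃ₗ[ℂ] (Fin 2 → ℂ),
      ∀ g i, br g (a (σ i)) = 0 → br (A g) (a i) = 0 := by
  choose k hk using fun i => exists_smul_of_ker_le (L := tang (a (σ i))) (M := tang (a i) ∘ₗ G)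
    fun z hz => (hGσ z i).mp hz
  have hGinj : Function.Injective G := by
    rw [injective_iff_map_eq_zero]
    intro z hz
    by_contra h0
    exact hG z h0 hz
  have hGsurj : Function.Surjective G := LinearMap.injective_iff_surjective.mp hGinj
  have hk0 : ∀ i, k i ≠ 0 := fun i h0 => by
    have hz : ∀ z, tang (a (σ i)) z = 0 := fun z => by rw [hk, h0, zero_mul]
    obtain ⟨j, hj⟩ := exists_ne (σ i)
    have := hz (symMul (a j) (a j))
    rw [tang_symMul] at this
    simp [h.br_ne j (σ i) hj] at this
  -- Since `tang (a (σ i))` is `k i` times `tang (a i) ∘ G`, a relation with coefficients `ω (σ i) *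
  -- g(a (σ i))` becomes one among the `tang (a i)`. Dividing by `ω i` must give the values of a
  -- linear form, which defines `A g`.
  let L : (Fin 2 → ℂ) →ₗ[ℂ] (Fin 5 → ℂ) :=
    LinearMap.pi fun i => (ω (σ i) * k i / ω i) • (LinearMap.proj (σ i) ∘ₗ lin a)
  have hL : ∀ g i, L g i = ω (σ i) * k i / ω i * br g (a (σ i)) := fun g i => by
    simp [L, lin_apply]
  have hrange : ∀ g, ∃ g', lin a g' = L g := fun g => by
    obtain ⟨g', hg'⟩ := h.exists_lin_of_sum_eq_zero (x := L g) fun z => by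
      obtain ⟨z, rfl⟩ := hGsurj z
      rw [← h.rel z g, ← Equiv.sum_comp σ fun i => ω i * (tang (a i) z * br g (a i))]
      refine Finset.sum_congr rfl fun i _ => ?_
      have := h.ne_zero i
      rw [hL, hk i z, LinearMap.comp_apply]
      field_simp
    exact ⟨g', hg'.symm⟩
  choose A hA using hrange
  let A' : (Fin 2 → ℂ) →ₗ[ℂ] (Fin 2 → ℂ) :=
    { toFun := A
      map_add' := fun x y => h.lin_injective (by simp only [map_add, hA])
      map_smul' := fun r x => h.lin_injective (by simp only [map_smul, hA, RingHom.id_apply]) }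
  have hinj : Function.Injective A' := by
    rw [injective_iff_map_eq_zero]
    intro g hg
    refine (injective_iff_map_eq_zero _).mp h.lin_injective g (funext fun j => ?_)
    obtain ⟨i, rfl⟩ := σ.surjective j
    have := congrFun (hA g) i
    rw [show A g = 0 from hg, map_zero, hL] at this
    simpa [h.ne_zero, hk0, lin_apply] using this.symm
  refine ⟨LinearEquiv.ofInjectiveEndo A' hinj, fun g i hgi => ?_⟩
  have := congrFun (hA g) i
  rw [hL, hgi, mul_zero] at this
  exact this

/-- Every nonzero `z` is reached from the surface by taking square roots of its values at the five
points. Hence the linear part of `β`, composed with these values, is defined everywhere and inherits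
the branch condition. -/
theorem exists_linearMap_of_isSquaringCover (h : IsWeighted (fun i => (p i).rep) ω)
    (hS : ∀ y, y ∈ S ↔ pencil (fun i => (p i).rep) ω (T y.rep) = 0)
    {e : Module.Basis (Fin 5) ℂ (Fin 5 → ℂ)} {β : S → PSpace 2} (hβ : IsSquaringCover p S e β)
    {σ : Equiv.Perm (Fin 5)} {t : Fin 5 → ℂ} (ht : ∀ i, t i ≠ 0)
    (he : ∀ v i, e.repr v i = T v (σ i) / t i) :
    ∃ G : (Fin 3 → ℂ) →ₗ[ℂ] (Fin 3 → ℂ), (∀ z, z ≠ 0 → G z ≠ 0) ∧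
      ∀ z i, tang (p i).rep (G z) = 0 ↔ tang (p (σ i)).rep z = 0 := by
  obtain ⟨⟨g, hg⟩, hline⟩ := hβ
  let G : (Fin 3 → ℂ) →ₗ[ℂ] (Fin 3 → ℂ) :=
    g ∘ₗ LinearMap.pi fun i => (1 / t i ^ 2) • tang (p (σ i)).rep
  have key : ∀ z, z ≠ 0 →
      G z ≠ 0 ∧ ∀ i, tang (p i).rep (G z) = 0 ↔ tang (p (σ i)).rep z = 0 := by
    intro z hz
    choose v hv using fun i => IsAlgClosed.exists_pow_nat_eq (tang (p i).rep z) (n := 2) (by norm_num)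
    have hv0 : T.symm v ≠ 0 := by
      intro h0
      apply hz
      refine (injective_iff_map_eq_zero _).mp h.quad_injective z (funext fun i => ?_)
      rw [T.symm.map_eq_zero_iff] at h0
      simp [quad_apply, ← hv, h0]
    obtain ⟨r, hr⟩ := Projectivization.exists_smul_eq_mk_rep ℂ _ hv0
    have hrep : T (Projectivization.mk ℂ _ hv0).rep = (r : ℂ) • v := by
      rw [← hr, Units.smul_def, map_smul, T.apply_symm_apply]
    have hy : Projectivization.mk ℂ _ hv0 ∈ S := by
      rw [hS, hrep, pencil_smul, h.pencil_quad_sqrt hv, smul_zero]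
    obtain ⟨hne, hβy⟩ := hg ⟨_, hy⟩
    have hGz : g (fun i => e.repr (Projectivization.mk ℂ _ hv0).rep i ^ 2) = (r : ℂ) ^ 2 • G z := by
      change _ = (r : ℂ) ^ 2 • g fun i => (1 / t i ^ 2) • tang (p (σ i)).rep z
      rw [← map_smul]
      congr 1
      ext i
      rw [he, hrep]
      simp [div_pow, mul_pow, hv]
      ring
    have hG0 : G z ≠ 0 := by
      intro h0
      rw [h0, smul_zero] at hGz
      exact hne hGz
    refine ⟨hG0, fun i => ?_⟩
    have h1 := Set.ext_iff.mp (hline i) ⟨_, hy⟩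
    rw [Set.mem_preimage, mem_tangentLine_iff, hβy, tang_mk_rep_eq_zero_iff, Set.mem_ofPred_eq, he,
      hrep] at h1
    simp only [hGz, map_smul] at h1
    simpa [← hv, ht i] using h1
  refine ⟨G, fun z hz => (key z hz).1, fun z i => ?_⟩
  by_cases hz : z = 0
  · simp [hz]
  · exact (key z hz).2 i

theorem IsVertexMatching.injective_and_range_and_exists_iso
    (h : IsWeighted (fun i => (p i).rep) ω)
    (hS : ∀ y, y ∈ S ↔ pencil (fun i => (p i).rep) ω (T y.rep) = 0)
    (hΦ : ∀ g v, (Φ g : QuadraticForm ℂ (Fin 5 → ℂ)) v =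
      br g (pencil (fun i => (p i).rep) ω (T v)))
    {l : Fin 5 → ParameterSpace S} (hl : IsVertexMatching p S l) :
    (Function.Injective l ∧ Set.range l = singularMembers S) ∧
      ∃ ι : ParameterSpace S → PSpace 1, IsProjectiveIso ι ∧ ∀ i, ι (l i) = p i := by
  obtain ⟨e, hv, β, hβ⟩ := hl
  obtain ⟨σ, t, ht, hlσ, he⟩ := exists_perm_of_isVertex h hΦ hv
  have hlσ' : l = singularParameter h Φ ∘ σ := funext hlσ
  obtain ⟨G, hG, hGσ⟩ := exists_linearMap_of_isSquaringCover h hS hβ ht he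
  obtain ⟨A, hA⟩ := exists_linearEquiv_of_tang h hG σ hGσ
  refine ⟨⟨?_, ?_⟩, _, ⟨Φ.symm.trans A, rfl⟩, fun i => ?_⟩
  · rw [hlσ']
    exact (singularParameter_injective h).comp σ.injective
  · rw [hlσ', Set.range_comp, σ.range_eq_univ, Set.image_univ, singularMembers_eq_range h hΦ]
  -- The linear form `(p (σ i)).rep` vanishes at `p (σ i)`, so its image under `A` vanishes at `p i`
  -- and is therefore a multiple of `(p i).rep`.
  · have hAi := hA _ i (br_self ((p (σ i)).rep))
    obtain ⟨r, hr⟩ := exists_smul_of_br_eq_zero (p i).rep_nonzero hAi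
    rw [hlσ, singularParameter, Projectivization.map_mk]
    conv_rhs => rw [← (p i).mk_rep]
    rw [Projectivization.mk_eq_mk_iff']
    refine ⟨r, ?_⟩
    rw [← hr]
    simp

end Matching

end PencilOfQuadrics

end
open PencilOfQuadrics in
theorem proposition4p1 (p : Fin 5 → PSpace 1) (hp : Function.Injective p) :
    Module.finrank ℂ (cubicsThrough p) = 5 ∧
    ∀ c : Module.Basis (Fin 5) ℂ (cubicsThrough p),
      -- the quadrics through `X` form a pencil, with base locus `X`
      Module.finrank ℂ (quadricsThrough (delPezzo c)) = 2 ∧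
      delPezzo c = {y | ∀ q ∈ quadricsThrough (delPezzo c), q y.rep = 0} ∧
      -- it has exactly five singular members, each with a single vertex
      (singularMembers (delPezzo c)).ncard = 5 ∧
      (∀ l ∈ singularMembers (delPezzo c), ∃! v, IsVertex l v) ∧
      -- singular members and marked points are matched through the vertices
      (∃ l, IsVertexMatching p (delPezzo c) l) ∧
      -- every such matching is a bijection and extends to an isomorphism `Λ ≅ C`
      ∀ l, IsVertexMatching p (delPezzo c) l →
        (Function.Injective l ∧ Set.range l = singularMembers (delPezzo c)) ∧
        ∃ ι : ParameterSpace (delPezzo c) → PSpace 1,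
          IsProjectiveIso ι ∧ ∀ i, ι (l i) = p i := by
  refine ⟨finrank_cubicsThrough hp, fun c => ?_⟩
  obtain ⟨ω, h⟩ := exists_isWeighted (a := fun i => (p i).rep)
    fun i j hij => br_rep_ne_zero (hp.ne hij)
  obtain ⟨s, hs⟩ := LinearMap.exists_rightInverse_of_surjective (proj (fun i => (p i).rep) ω)
    (LinearMap.range_eq_top.mpr h.proj_surjective)
  have hs' : ∀ q, proj (fun i => (p i).rep) ω (s q) = q := LinearMap.congr_fun hs
  obtain ⟨T, hT⟩ := exists_linearEquiv_param h hs' c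
  have hS := mem_delPezzo_iff h hs' hT
  obtain ⟨Φ, hΦ⟩ := h.exists_linearEquiv_quadricsThrough hS
  refine ⟨?_, eq_base_locus hS hΦ, ncard_singularMembers h hΦ, ?_,
    ⟨_, isVertexMatching_singularParameter h hS hΦ⟩,
    fun l hl => hl.injective_and_range_and_exists_iso h hS hΦ⟩
  · rw [← Φ.finrank_eq, Module.finrank_fin_fun]
  · rw [singularMembers_eq_range h hΦ]
    rintro _ ⟨i, rfl⟩
    exact existsUnique_isVertex h hΦ i
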